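/- \textbf{Setting.} Let $v_1=(0,0)$, $v_2=(1,0)$, $v_3=(1/2,\sqrt3/2)$, $F_i(x)=\frac12(x+v_i)$ on $\mathbb{R}^2$, $V_0=\{v_1,v_2,v_3\}$, $V_{m+1}=\bigcup_i F_i(V_m)$ and $\hat V_m=\bigcup_{k\ge0}2^k[V_{m+k}\cup(-V_{m+k})]$. The Sierpinski gasket is $\mathbb{S}=\overline{\bigcup_m V_m}$ and the infinite Sierpinski gasket is $\hat{\mathbb{S}}=\overline{\bigcup_m\hat V_m}$. It is the union of the unit cells $\tau_i(\mathbb{S})$, where the $\tau_i$ are the maps $x\mapsto\pm(x+t)$ with $t=2^{k}F_{w_1}\cdots F_{w_k}(0)$ for some $k\ge0$ and $w_1,\dots,w_k\in\{1,2,3\}$ (each map is listed once). A \emph{dyadic triangle} is a set $2^m\tau_i(\mathbb{S})$ with $m\in\mathbb{Z}$. Let $\nu$ be the Borel probability measure on $\mathbb{S}$ that gives mass $3^{-m}$ to each $F_{w_1}\cdots F_{w_m}(\mathbb{S})$, and let $\hat\nu$ be the Borel measure on $\hat{\mathbb{S}}$ obtained by putting a copy of $\nu$ on each unit cell, so that $\hat\nu(S)=3^m$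 for a dyadic triangle $S$ of side $2^m$. For $u:\hat{\mathbb{S}}\to\mathbb{R}$ put $$\hat{\mathcal{E}}(u)=\lim_{m\to\infty}\ \sum_{x\sim_m y}\tfrac12\left(\tfrac53\right)^m\,[u(x)-u(y)]^2\in[0,\infty],$$ where the sum runs over ordered pairs of distinct points $x,y$ that both lie in $2^{-m}\tau_i(V_0)$ for some $i$ (the sequence is nondecreasing in $m\ge 0$), and let $\mathcal{F}(\hat{\mathbb{S}})$ be the set of continuous $u\in L^2(\hat\nu)$ with $\hat{\mathcal{E}}(u)<\infty$, which is complete in the norm $\hat{\mathcal{E}}(\cdot)^{1/2}+\Vert\cdot\Vert_{L^2(\hat\nu)}$. Define $\delta_s$ by $1/\delta_s=\log5/\log3-1$. Diameters are Euclidean. \textbf{Theorem.} Let $1\le p\le q\le\infty$, $q\ge2$, and let $\hat\sigma$ be a Borel measure on $\hat{\mathbb{S}}$ for which there are constants $C_{\hat\sigma}\ge1$ and $0<\underline\delta\le\bar\delta<\infty$ such that, for every dyadic triangle $S$, $$C_{\hat\sigma}^{-1}\hat\nu(S)^{1/\underline\delta}\le\hat\sigma(S)\ \text{ if } 0<\mathrm{diam}(S)<1,\qquad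 C_{\hat\sigma}^{-1}\hat\nu(S)^{1/\bar\delta}\le\hat\sigma(S)\ \text{ if } \mathrm{diam}(S)\ge1.\tag{M.1'}$$ Then there is a constant $C>0$ depending only on $C_{\hat\sigma}$ such that $$\Vert u\Vert_{L^q(\hat\nu)}\le C\sum_{i=1,2}\hat{\mathcal{E}}(u)^{a_i/2}\,\Vert u\Vert_{L^p(\hat\sigma)}^{1-a_i},\qquad u\in\mathcal{F}(\hat{\mathbb{S}}),$$ where (with $1/\infty=0$ and $[x]^+=\max(x,0)$) $$a_1=\left[\frac{1/(p\underline\delta)-1/q}{1/(p\underline\delta)+1/(2\delta_s)}\right]^+,\qquad a_2=\left[\frac{1/(p\bar\delta)-1/q}{1/(p\bar\delta)+1/(2\delta_s)}\right]^+ .$$ Moreover, suppose in addition that there are dyadic triangles $(S_m)_{m\in\mathbb{Z}}$ with $\mathrm{diam}(S_m)\to0$ as $m\to-\infty$, $\mathrm{diam}(S_m)\to\infty$ as $m\to\infty$, and $$\frac1{\underline\delta}=\lim_{m\to-\infty}\frac{\log\hat\sigma(S_m)}{\log\hat\nu(S_m)},\qquad \frac1{\bar\delta}=\lim_{m\to\infty}\frac{\log\hat\sigma(S_m)}{\log\hat\nu(S_m)}.\tag{M.2'}$$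 Then the exponents are optimal in the following sense: if, for some $N\ge1$, $b_1,\dots,b_N\in[0,1]$ and $C>0$, $$\Vert u\Vert_{L^q(\hat\nu)}\le C\sum_{i=1}^N\hat{\mathcal{E}}(u)^{b_i/2}\,\Vert u\Vert_{L^p(\hat\sigma)}^{1-b_i}$$ for all $u\in\mathcal{F}(\hat{\mathbb{S}})$ with $\Vert u\Vert_{L^p(\hat\sigma)}<\infty$, then $\min_i b_i\le a_2\le a_1\le\max_i b_i$. -/

import Mathlib

open MeasureTheory Filter Topology

namespace SierpinskiGasket

/-! ### The gasket and the infinite gasket -/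

/-- The Euclidean plane. -/
abbrev Plane : Type := EuclideanSpace ℝ (Fin 2)

/-- The three corners `(0,0)`, `(1,0)`, `(1/2, √3/2)`. -/
noncomputable def corner : Fin 3 → Plane :=
  ![!₂[0, 0], !₂[1, 0], !₂[1 / 2, Real.sqrt 3 / 2]]

/-- The contractions `F i x = (x + corner i) / 2`. -/
noncomputable def F (i : Fin 3) (x : Plane) : Plane := (2⁻¹ : ℝ) • (x + corner i)

/-- `Fword [w₁, …, wₙ] = F w₁ ∘ ⋯ ∘ F wₙ`. -/
noncomputable def Fword : List (Fin 3) → Plane → Plane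
  | [], x => x
  | i :: w, x => F i (Fword w x)

/-- `V 0` is the set of corners and `V (m + 1) = ⋃ i, F i (V m)`. -/
noncomputable def V : ℕ → Set Plane
  | 0 => Set.range corner
  | m + 1 => ⋃ i : Fin 3, F i '' V m

/-- The vertices `⋃ k, 2 ^ k (V (m + k) ∪ -V (m + k))` of the infinite gasket. -/
noncomputable def infV (m : ℕ) : Set Plane :=
  ⋃ k : ℕ, (fun x : Plane => (2 ^ k : ℝ) • x) '' (V (m + k) ∪ (fun x : Plane => -x) '' V (m + k))

/-- The compact Sierpinski gasket. -/
noncomputable def gasket : Set Plane := closure (⋃ m : ℕ, V m)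

/-- The infinite Sierpinski gasket. -/
noncomputable def infGasket : Set Plane := closure (⋃ m : ℕ, infV m)

/-- The translation vectors `t` such that `t + gasket` is a cell of side one of the
one-sided infinite gasket `⋃ k, 2 ^ k gasket`. -/
noncomputable def offsets : Set Plane :=
  Set.range fun w : List (Fin 3) => (2 ^ w.length : ℝ) • Fword w 0

/-- Labels of the cells of side one of the infinite gasket: a sign and a translation vector. -/
abbrev CellIndex : Type := ℤˣ × offsets

/-- The isometry `x ↦ ± (x + t)`, which maps the gasket onto a cell of side one. The sign is
needed because `-gasket`, a subset of the infinite gasket, is not a translate of `gasket`. -/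
noncomputable def cellMap (i : CellIndex) (x : Plane) : Plane :=
  ((i.1 : ℤ) : ℝ) • (x + (i.2 : Plane))

/-- The map `x ↦ 2 ^ m · cellMap i x`. -/
noncomputable def dyadicMap (i : CellIndex) (m : ℤ) (x : Plane) : Plane :=
  ((2 : ℝ) ^ m) • cellMap i x

/-- The dyadic triangle of side `2 ^ m` with label `i`, as a subset of the infinite gasket. -/
noncomputable def dyadicTriangle (i : CellIndex) (m : ℤ) : Set infGasket :=
  Subtype.val ⁻¹' (dyadicMap i m '' gasket)

def IsDyadicTriangle (S : Set infGasket) : Prop :=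
  ∃ (i : CellIndex) (m : ℤ), S = dyadicTriangle i m

/-! ### The Hausdorff measure -/

/-- The point `lim F ω₀ ∘ ⋯ ∘ F ωₙ (0) = ∑ 2 ^ (-(n + 1)) corner (ω n)` with address `ω`. -/
noncomputable def coding (ω : ℕ → Fin 3) : Plane :=
  ∑' n : ℕ, ((2⁻¹ : ℝ) ^ (n + 1)) • corner (ω n)

/-- The normalised Hausdorff measure of the compact gasket: the image under the coding map of
the uniform Bernoulli measure, that is, the Borel probability measure that gives mass `3 ^ (-m)`
to each cell of generation `m`. -/
noncomputable def gasketMeasure : Measure Plane :=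
  (Measure.infinitePi fun _ : ℕ => (PMF.uniformOfFintype (Fin 3)).toMeasure).map coding

/-- The Hausdorff measure of the infinite gasket: a copy of `gasketMeasure` on each cell of
side one. -/
noncomputable def infMeasure : Measure infGasket :=
  Measure.comap Subtype.val (Measure.sum fun i : CellIndex => gasketMeasure.map (cellMap i))

/-! ### The standard Dirichlet form -/

/-- `x` and `y` are neighbours at level `m`: distinct vertices (hence at distance `2 ^ (-m)`) of
one and the same cell of side `2 ^ (-m)`. -/
def Neighbours (m : ℕ) (x y : infGasket) : Prop :=
  x ≠ y ∧ ∃ i : CellIndex, (x : Plane) ∈ dyadicMap i (-(m : ℤ)) '' V 0 ∧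
    (y : Plane) ∈ dyadicMap i (-(m : ℤ)) '' V 0

/-- The level `m` energy `∑ (1/2) (5/3) ^ m (u x - u y) ^ 2`, the sum being over all ordered
pairs of neighbours. -/
noncomputable def levelEnergy (m : ℕ) (u : infGasket → ℝ) : ENNReal :=
  ∑' e : {e : infGasket × infGasket // Neighbours m e.1 e.2},
    ENNReal.ofReal (2⁻¹ * (5 / 3 : ℝ) ^ m * (u e.1.1 - u e.1.2) ^ 2)

/-- The energy of `u`, the limit of the nondecreasing sequence of level energies. -/
noncomputable def energy (u : infGasket → ℝ) : ENNReal := ⨆ m : ℕ, levelEnergy m u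

/-- The domain of the Dirichlet form: continuous functions of finite energy that are
square-integrable. This space is complete in the norm `energy ^ (1/2) + L²`. -/
def formDomain : Set (infGasket → ℝ) :=
  {u | Continuous u ∧ energy u < ⊤ ∧ MemLp u 2 infMeasure}

/-! ### The conditions on the measure and the exponents -/

/-- The constant with `1 / δ = log 5 / log 3 - 1`. -/
noncomputable def deltaS : ℝ := 1 / (Real.log 5 / Real.log 3 - 1)

/-- The lower dyadic condition with constant `C`, exponent `1 / δl` for dyadic triangles of
diameter less than one and exponent `1 / δu` for the others. -/
def LowerDyadic (σ : Measure infGasket) (C δl δu : ℝ) : Prop :=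
  ∀ S : Set infGasket, IsDyadicTriangle S →
    ((0 < Metric.diam S ∧ Metric.diam S < 1) →
      ENNReal.ofReal C⁻¹ * infMeasure S ^ (1 / δl) ≤ σ S) ∧
    (1 ≤ Metric.diam S → ENNReal.ofReal C⁻¹ * infMeasure S ^ (1 / δu) ≤ σ S)

/-- There are dyadic triangles `T m`, shrinking as `m → -∞` and growing as `m → ∞`, along which
the local dimensions of `σ` relative to the Hausdorff measure are `1 / δl` and `1 / δu`.
The limits are positive, so the values `log 0 = 0` and `(⊤ : ENNReal).toReal = 0` occur for at
most those `m` that do not matter for the limits. -/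
def SharpDyadic (σ : Measure infGasket) (δl δu : ℝ) : Prop :=
  ∃ T : ℤ → Set infGasket, (∀ m, IsDyadicTriangle (T m)) ∧
    Tendsto (fun m => Metric.diam (T m)) atBot (𝓝 0) ∧
    Tendsto (fun m => Metric.diam (T m)) atTop atTop ∧
    Tendsto (fun m => Real.log (σ (T m)).toReal / Real.log (infMeasure (T m)).toReal)
      atBot (𝓝 (1 / δl)) ∧
    Tendsto (fun m => Real.log (σ (T m)).toReal / Real.log (infMeasure (T m)).toReal)
      atTop (𝓝 (1 / δu))

/-- The exponent `[(1/(pδ) - 1/q) / (1/(pδ) + 1/(2δₛ))]⁺`, where `1/∞ = 0`. -/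
noncomputable def exponent (p q : ENNReal) (δ : ℝ) : ℝ :=
  max ((p⁻¹.toReal / δ - q⁻¹.toReal) / (p⁻¹.toReal / δ + 1 / (2 * deltaS))) 0

end SierpinskiGasket

open SierpinskiGasket

namespace SierpinskiGasket

/-! The inequality comes from one estimate at every scale `k` (`eLpNorm_le_at_scale`). On a cell of
side `2 ^ k`, `|u|` is at most its infimum plus twice a bound for the oscillation. The infima are
controlled by `σ`: the cells overlap at most six times, so the lower bound on `σ` of a cell bounds
the `p`-th power sum of the infima by the `L^p(σ)` norm. The oscillations are controlled by the
energy: chaining along vertices bounds the sum of their squares by a constant times `(5/3) ^ k *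
energy u` (`tsum_oscBound_le`). Since `p ≤ q` and `2 ≤ q`, both sequences may be measured in `ℓ^q`,
and each cell has mass `3 ^ k`. With `e = energy ^ (1/2)` and `n` the `L^p(σ)` norm, this gives
`‖u‖_q ≲ 3 ^ (k A) e + 3 ^ (-k B) n`, where `A = 1/q + 1/(2δₛ)` and `B = 1/(pδ) - 1/q`. Balancing
the two terms in `k` (`exists_scale`) produces the exponent `[B / (A + B)]⁺`. The balancing scale is
nonnegative if `e ≤ n` and nonpositive if `n < e`, so exactly one of the two dyadic exponents is
relevant for a given `u`. This is why two terms appear.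

Optimality is tested on bumps supported in a single cell `S` of side `2 ^ k`. They have energy at
most of order `(5/3) ^ (-k)`, `L^p(σ)` norm at most `σ(S) ^ (1/p)`, and `L^q` norm at least of order
`3 ^ (k/q)`. Writing `σ(S) = 3 ^ (k y)`, an inequality with exponents `b j` becomes `1 ≲ ∑ j, 3 ^ (k
(-b j/(2δₛ) - 1/q + y (1 - b j)/p))`. Letting `k → ±∞` along the given triangles, some summand fails
to tend to zero, and the sign of its limiting growth rate compares that `b j` with the claimed
exponent.

The geometry is done through infinite addresses. The point with address `ω` has nonnegative
barycentric coordinates of sum at most one, and translation vectors of cells have natural ones;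
hence distinct cells of equal side meet only at common corners (`cell_inter`). Every cell is a child
of a unique cell of twice the side (`childEquiv`), so all scales, large and small, are treated
alike. -/

/-! ### Barycentric coordinates -/

/-- The barycentric coordinate of `x` with respect to the second corner. -/
noncomputable def baryX : Plane →L[ℝ] ℝ :=
  EuclideanSpace.proj 0 - (Real.sqrt 3)⁻¹ • EuclideanSpace.proj 1

/-- The barycentric coordinate of `x` with respect to the third corner. -/
noncomputable def baryY : Plane →L[ℝ] ℝ :=
  (2 * (Real.sqrt 3)⁻¹) • EuclideanSpace.proj 1

lemma baryX_apply (x : Plane) : baryX x = x 0 - (Real.sqrt 3)⁻¹ * x 1 := rfl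

lemma baryY_apply (x : Plane) : baryY x = 2 * (Real.sqrt 3)⁻¹ * x 1 := rfl

lemma plane_ext {x y : Plane} (hX : baryX x = baryX y) (hY : baryY x = baryY y) : x = y := by
  have h3 : Real.sqrt 3 ≠ 0 := by positivity
  rw [baryX_apply, baryX_apply] at hX
  rw [baryY_apply, baryY_apply] at hY
  have h1 : x 1 = y 1 := by
    have : 2 * (Real.sqrt 3)⁻¹ ≠ 0 := by positivity
    exact mul_left_cancel₀ this hY
  have h0 : x 0 = y 0 := by rw [h1] at hX; linarith
  ext i
  fin_cases i
  · exact h0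
  · exact h1

@[simp] lemma corner_zero : corner 0 = 0 := by
  ext i; fin_cases i <;> simp [corner]

lemma baryX_corner (a : Fin 3) : baryX (corner a) = if a = 1 then 1 else 0 := by
  have h3 : Real.sqrt 3 ≠ 0 := by positivity
  fin_cases a <;> simp [baryX, corner]
  field_simp
  norm_num

lemma baryY_corner (a : Fin 3) : baryY (corner a) = if a = 2 then 1 else 0 := by
  have h3 : Real.sqrt 3 ≠ 0 := by positivity
  fin_cases a <;> simp [baryY, corner]
  field_simp

lemma baryX_F (a : Fin 3) (x : Plane) :
    baryX (F a x) = (baryX x + if a = 1 then 1 else 0) / 2 := by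
  rw [F, map_smul, map_add, baryX_corner, smul_eq_mul]; ring

lemma baryY_F (a : Fin 3) (x : Plane) :
    baryY (F a x) = (baryY x + if a = 2 then 1 else 0) / 2 := by
  rw [F, map_smul, map_add, baryY_corner, smul_eq_mul]; ring

lemma corner_injective : Function.Injective corner := by
  intro a b h
  have hX := congrArg baryX h
  have hY := congrArg baryY h
  rw [baryX_corner, baryX_corner] at hX
  rw [baryY_corner, baryY_corner] at hY
  fin_cases a <;> fin_cases b <;> simp_all

lemma F_corner_self (a : Fin 3) : F a (corner a) = corner a := by
  rw [F, ← two_smul ℝ, smul_smul]; norm_num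

lemma F_corner_comm (a b : Fin 3) : F a (corner b) = F b (corner a) := by
  rw [F, F, add_comm]

lemma F_injective (a : Fin 3) : Function.Injective (F a) := by
  intro x y h
  have := smul_right_injective Plane (by norm_num : (2⁻¹ : ℝ) ≠ 0) h
  simpa using this

/-! ### Addresses -/

/-- Infinite words over the alphabet `Fin 3`. -/
abbrev Addr : Type := ℕ → Fin 3

/-- The word `a :: ω`. -/
def Addr.cons (a : Fin 3) (ω : Addr) : Addr
  | 0 => a
  | n + 1 => ω n

/-- The constant word `a a a …`. -/
def Addr.const (a : Fin 3) : Addr := fun _ => a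

/-- The word without its first letter. -/
def Addr.tail (ω : Addr) : Addr := fun n => ω (n + 1)

/-- The finite word `w` followed by `ω`. -/
def Addr.append : List (Fin 3) → Addr → Addr
  | [], ω => ω
  | a :: w, ω => Addr.cons a (Addr.append w ω)

lemma Addr.cons_tail (ω : Addr) : Addr.cons (ω 0) ω.tail = ω := by
  funext n; cases n <;> rfl

lemma Addr.cons_const (a : Fin 3) : Addr.cons a (Addr.const a) = Addr.const a := by
  funext n; cases n <;> rfl

lemma norm_corner_le (a : Fin 3) : ‖corner a‖ ≤ 1 := by
  have h3 : Real.sqrt 3 ^ 2 = 3 := Real.sq_sqrt (by norm_num)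
  rw [EuclideanSpace.norm_eq, Real.sqrt_le_one]
  fin_cases a <;> simp [corner, Fin.sum_univ_two]
  rw [div_pow, h3]; norm_num

lemma coding_term_le (ω : Addr) (n : ℕ) :
    ‖((2⁻¹ : ℝ) ^ (n + 1)) • corner (ω n)‖ ≤ (2⁻¹ : ℝ) ^ (n + 1) := by
  rw [norm_smul, Real.norm_of_nonneg (by positivity)]
  exact mul_le_of_le_one_right (by positivity) (norm_corner_le _)

lemma summable_half_pow_succ : Summable fun n : ℕ => (2⁻¹ : ℝ) ^ (n + 1) :=
  (summable_nat_add_iff 1).2 (summable_geometric_of_lt_one (by norm_num) (by norm_num))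

lemma summable_coding (ω : Addr) : Summable fun n : ℕ => ((2⁻¹ : ℝ) ^ (n + 1)) • corner (ω n) :=
  Summable.of_norm_bounded summable_half_pow_succ (coding_term_le ω)

lemma continuous_coding : Continuous coding := by
  refine continuous_tsum (fun n => ?_) summable_half_pow_succ (fun n ω => coding_term_le ω n)
  have h : Continuous fun ω : Addr => corner (ω n) :=
    (continuous_of_discreteTopology (f := corner)).comp (continuous_apply (A := fun _ => Fin 3) n)
  exact h.const_smul ((2⁻¹ : ℝ) ^ (n + 1))

lemma coding_cons (a : Fin 3) (ω : Addr) : coding (Addr.cons a ω) = F a (coding ω) := by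
  rw [coding, (summable_coding _).tsum_eq_zero_add, F, smul_add, add_comm, coding,
    ← tsum_const_smul'' (2⁻¹ : ℝ)]
  simp only [Addr.cons, zero_add, pow_one, smul_smul]
  congr 1
  exact tsum_congr fun n => by rw [← pow_succ']

lemma coding_eq (ω : Addr) : coding ω = F (ω 0) (coding ω.tail) := by
  rw [← coding_cons, Addr.cons_tail]

@[simp] lemma coding_const (a : Fin 3) : coding (Addr.const a) = corner a := by
  have h := coding_cons a (Addr.const a)
  rw [Addr.cons_const, F] at h
  have h2 : (2⁻¹ : ℝ) • coding (Addr.const a) = (2⁻¹ : ℝ) • corner a := by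
    have : coding (Addr.const a) - (2⁻¹ : ℝ) • coding (Addr.const a) = (2⁻¹ : ℝ) • corner a := by
      nth_rewrite 1 [h]; rw [smul_add]; abel
    rw [← this]
    nth_rewrite 2 [← one_smul ℝ (coding (Addr.const a))]
    rw [← sub_smul]; norm_num
  exact smul_right_injective Plane (by norm_num : (2⁻¹ : ℝ) ≠ 0) h2

lemma coding_append (w : List (Fin 3)) (ω : Addr) :
    coding (Addr.append w ω) = Fword w (coding ω) := by
  induction w with
  | nil => rfl
  | cons a w ih => rw [Addr.append, coding_cons, ih]; rfl

lemma coding_cons_const_comm (a b : Fin 3) :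
    coding (Addr.cons a (Addr.const b)) = coding (Addr.cons b (Addr.const a)) := by
  simp only [coding_cons, coding_const]; exact F_corner_comm a b

/-! ### The gasket as the set of coded points -/

lemma V_eq (m : ℕ) : V m = {x | ∃ (w : List (Fin 3)) (a : Fin 3), w.length = m ∧
    Fword w (corner a) = x} := by
  induction m with
  | zero =>
    ext x
    constructor
    · rintro ⟨a, rfl⟩; exact ⟨[], a, rfl, rfl⟩
    · rintro ⟨w, a, hw, rfl⟩
      rw [List.length_eq_zero_iff.1 hw]; exact ⟨a, rfl⟩
  | succ m ih =>
    ext x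
    simp only [V, Set.mem_iUnion, ih]
    constructor
    · rintro ⟨i, _, ⟨w, a, hw, rfl⟩, rfl⟩
      exact ⟨i :: w, a, by simp [hw], rfl⟩
    · rintro ⟨_ | ⟨i, w⟩, a, hw, rfl⟩
      · simp at hw
      · exact ⟨i, _, ⟨w, a, by simpa using hw, rfl⟩, rfl⟩

lemma Fword_append (w v : List (Fin 3)) (x : Plane) : Fword (w ++ v) x = Fword w (Fword v x) := by
  induction w with
  | nil => rfl
  | cons a w ih => simp only [List.cons_append, Fword, ih]

lemma Fword_eq (w : List (Fin 3)) (x : Plane) :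
    Fword w x = ((2 : ℝ) ^ w.length)⁻¹ • x + Fword w 0 := by
  induction w with
  | nil => simp [Fword]
  | cons a w ih =>
    simp only [Fword, F, List.length_cons]
    rw [ih, pow_succ', mul_inv, mul_smul, ← smul_add, add_assoc]

lemma V_mono {m n : ℕ} (h : m ≤ n) : V m ⊆ V n := by
  refine monotone_nat_of_le_succ (fun k => ?_) h
  intro x hx
  rw [V_eq] at hx ⊢
  obtain ⟨w, a, hw, rfl⟩ := hx
  exact ⟨w ++ [a], a, by simp [hw], by rw [Fword_append]; simp [Fword, F_corner_self]⟩

lemma half_mem_V {m : ℕ} {x : Plane} (h : x ∈ V m) : (2⁻¹ : ℝ) • x ∈ V (m + 1) :=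
  Set.mem_iUnion.2 ⟨0, x, h, by simp [F]⟩

/-- The first `n` letters of `ω`, followed by zeros. -/
def Addr.trunc (ω : Addr) (n : ℕ) : Addr := fun j => if j < n then ω j else 0

lemma Addr.trunc_zero (ω : Addr) : ω.trunc 0 = Addr.const 0 := rfl

lemma Addr.trunc_succ (ω : Addr) (n : ℕ) : ω.trunc (n + 1) = Addr.cons (ω 0) (ω.tail.trunc n) := by
  funext j; cases j <;> simp [Addr.trunc, Addr.cons, Addr.tail]

lemma Addr.tendsto_trunc (ω : Addr) : Tendsto ω.trunc atTop (𝓝 ω) := by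
  refine tendsto_pi_nhds.2 fun j => tendsto_const_nhds.congr' ?_
  filter_upwards [eventually_gt_atTop j] with n hn
  simp [Addr.trunc, hn]

lemma coding_trunc_mem (n : ℕ) (ω : Addr) : coding (ω.trunc n) ∈ V n := by
  induction n generalizing ω with
  | zero => rw [Addr.trunc_zero, coding_const]; exact ⟨0, rfl⟩
  | succ n ih =>
    rw [Addr.trunc_succ, coding_cons]
    exact Set.mem_iUnion.2 ⟨_, _, ih _, rfl⟩

/-- Vertices have eventually constant addresses and the address space is compact. Conversely,
truncating an address gives vertices that converge to the coded point. -/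
lemma gasket_eq_range : gasket = Set.range coding := by
  apply Set.Subset.antisymm
  · refine closure_minimal ?_ (isCompact_range continuous_coding).isClosed
    refine Set.iUnion_subset fun m x hx => ?_
    rw [V_eq] at hx
    obtain ⟨w, a, -, rfl⟩ := hx
    exact ⟨Addr.append w (Addr.const a), by rw [coding_append, coding_const]⟩
  · rintro _ ⟨ω, rfl⟩
    refine mem_closure_of_tendsto ((continuous_coding.tendsto ω).comp (Addr.tendsto_trunc ω)) ?_
    exact Eventually.of_forall fun n => Set.mem_iUnion.2 ⟨n, coding_trunc_mem n ω⟩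

lemma isClosed_nonneg_bary : IsClosed {x : Plane | 0 ≤ baryX x ∧ 0 ≤ baryY x ∧
    baryX x + baryY x ≤ 1} := by
  refine (isClosed_le continuous_const baryX.continuous).inter
    ((isClosed_le continuous_const baryY.continuous).inter
      (isClosed_le (baryX.continuous.add baryY.continuous) continuous_const))

lemma bary_coding (ω : Addr) : 0 ≤ baryX (coding ω) ∧ 0 ≤ baryY (coding ω) ∧
    baryX (coding ω) + baryY (coding ω) ≤ 1 := by
  have hV : ∀ m, ∀ x ∈ V m, 0 ≤ baryX x ∧ 0 ≤ baryY x ∧ baryX x + baryY x ≤ 1 := by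
    intro m
    induction m with
    | zero =>
      rintro _ ⟨a, rfl⟩
      rw [baryX_corner, baryY_corner]
      fin_cases a <;> simp
    | succ m ih =>
      intro x hx
      obtain ⟨a, y, hy, rfl⟩ := Set.mem_iUnion.1 hx
      obtain ⟨h1, h2, h3⟩ := ih y hy
      rw [baryX_F, baryY_F]
      fin_cases a <;> simp <;> refine ⟨?_, ?_, ?_⟩ <;> linarith
  have : coding ω ∈ gasket := gasket_eq_range ▸ ⟨ω, rfl⟩
  exact closure_minimal (Set.iUnion_subset hV) isClosed_nonneg_bary this

/-- Only the subcell at `corner a` contains that corner, which forces the first letter; the tail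
then codes the same corner. Other vertices can have two addresses, so this is special to the three
outer corners. -/
lemma coding_eq_corner {a : Fin 3} {ω : Addr} (h : coding ω = corner a) : ω = Addr.const a := by
  have key : ∀ n, ∀ ω : Addr, coding ω = corner a → ω n = a := by
    have h0 : ∀ ω : Addr, coding ω = corner a → ω 0 = a := by
      intro ω h
      rw [coding_eq] at h
      have hX := congrArg baryX h
      have hY := congrArg baryY h
      rw [baryX_F, baryX_corner] at hX
      rw [baryY_F, baryY_corner] at hY
      obtain ⟨h1, h2, h3⟩ := bary_coding ω.tail
      generalize ω 0 = b at *
      fin_cases a <;> fin_cases b <;> simp at hX hY ⊢ <;> linarith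
    intro n
    induction n with
    | zero => exact h0
    | succ n ih =>
      intro ω h
      refine ih ω.tail ?_
      have h' := h
      rw [coding_eq, h0 ω h, ← F_corner_self a] at h'
      exact F_injective _ h'
  funext n; exact key n ω h

/-! ### Cells of the infinite gasket -/

/-- The translation vector with ternary digits `w`. -/
noncomputable def offset (w : List (Fin 3)) : Plane := (2 ^ w.length : ℝ) • Fword w 0

lemma offset_nil : offset [] = 0 := by simp [offset, Fword]

lemma offset_concat (w : List (Fin 3)) (a : Fin 3) :
    offset (w ++ [a]) = (2 : ℝ) • offset w + corner a := by
  have h2 : (2 : ℝ) ^ w.length ≠ 0 := by positivity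
  rw [offset, offset, Fword_append, Fword_eq w]
  simp only [Fword, F, zero_add, List.length_append, List.length_cons, List.length_nil, smul_add,
    smul_smul]
  rw [add_comm, pow_succ, mul_comm _ (2 : ℝ)]
  congr 1
  rw [show 2 * (2 : ℝ) ^ w.length * (((2 : ℝ) ^ w.length)⁻¹ * 2⁻¹) = 1 by field_simp, one_smul]

lemma zero_mem_offsets : (0 : Plane) ∈ offsets := ⟨[], offset_nil⟩

lemma child_mem_offsets {t : Plane} (ht : t ∈ offsets) (a : Fin 3) :
    (2 : ℝ) • t + corner a ∈ offsets := by
  obtain ⟨w, rfl⟩ := ht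
  exact ⟨w ++ [a], offset_concat w a⟩

/-- One of the two cells at the origin. -/
noncomputable def rootCell (s : ℤˣ) : CellIndex := (s, ⟨0, zero_mem_offsets⟩)

/-- The label of the subcell of the cell `i` at its corner `a`. -/
noncomputable def child (i : CellIndex) (a : Fin 3) : CellIndex :=
  (i.1, ⟨(2 : ℝ) • (i.2 : Plane) + corner a, child_mem_offsets i.2.2 a⟩)

/-- Appending a ternary digit at the end of a word is passing to a subcell, so every label is
reached from a root by finitely many subdivisions. -/
lemma cellIndex_induction {P : CellIndex → Prop} (h0 : ∀ s, P (rootCell s))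
    (h1 : ∀ i a, P i → P (child i a)) (i : CellIndex) : P i := by
  obtain ⟨s, t, w, hw⟩ := i
  induction w using List.reverseRecOn generalizing t with
  | nil =>
    have : t = 0 := by rw [← hw]; exact offset_nil
    subst this
    exact h0 s
  | append_singleton w a ih =>
    have : t = (2 : ℝ) • offset w + corner a := by rw [← hw]; exact offset_concat w a
    subst this
    exact h1 (s, ⟨offset w, w, rfl⟩) a (ih _ rfl)

/-- Labels carry no scale, and the subcell at the origin of a cell at the origin is again at the
origin. Hence even the roots have parents, and there is no largest scale. -/
lemma rootCell_eq_child (s : ℤˣ) : rootCell s = child (rootCell s) 0 := by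
  simp [rootCell, child]

lemma exists_eq_child (i : CellIndex) : ∃ j a, i = child j a := by
  induction i using cellIndex_induction with
  | h0 s => exact ⟨_, _, rootCell_eq_child s⟩
  | h1 i a _ => exact ⟨i, a, rfl⟩

lemma offset_bary (i : CellIndex) :
    ∃ m n : ℕ, baryX (i.2 : Plane) = m ∧ baryY (i.2 : Plane) = n := by
  induction i using cellIndex_induction with
  | h0 s => exact ⟨0, 0, by simp [rootCell]⟩
  | h1 i a ih =>
    obtain ⟨m, n, hm, hn⟩ := ih
    refine ⟨2 * m + if a = 1 then 1 else 0, 2 * n + if a = 2 then 1 else 0, ?_, ?_⟩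
    · simp [child, hm, baryX_corner]
    · simp [child, hn, baryY_corner]

lemma cellIndex_ext {i j : CellIndex} (hs : i.1 = j.1)
    (hX : baryX (i.2 : Plane) = baryX (j.2 : Plane))
    (hY : baryY (i.2 : Plane) = baryY (j.2 : Plane)) : i = j :=
  Prod.ext hs (Subtype.ext (plane_ext hX hY))

lemma child_injective {i j : CellIndex} {a b : Fin 3} (h : child i a = child j b) :
    i = j ∧ a = b := by
  have hs : (child i a).1 = (child j b).1 := by rw [h]
  have ht : (2 : ℝ) • (i.2 : Plane) + corner a = (2 : ℝ) • (j.2 : Plane) + corner b :=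
    congrArg (fun c : CellIndex => (c.2 : Plane)) h
  change i.1 = j.1 at hs
  have hX := congrArg baryX ht
  have hY := congrArg baryY ht
  obtain ⟨m, n, hm, hn⟩ := offset_bary i
  obtain ⟨m', n', hm', hn'⟩ := offset_bary j
  simp only [map_add, map_smul, smul_eq_mul, hm, hn, hm', hn', baryX_corner, baryY_corner] at hX hY
  norm_cast at hX hY
  have ha : a = b := by
    fin_cases a <;> fin_cases b <;> simp at hX hY ⊢ <;> omega
  subst ha
  refine ⟨cellIndex_ext hs ?_ ?_, rfl⟩
  · rw [hm, hm']; congr 1; omega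
  · rw [hn, hn']; congr 1; omega

/-- Every cell is a subcell of exactly one cell of twice the size. -/
noncomputable def childEquiv : CellIndex × Fin 3 ≃ CellIndex :=
  Equiv.ofBijective (fun x => child x.1 x.2)
    ⟨fun _ _ h => Prod.ext (child_injective h).1 (child_injective h).2,
      fun i => let ⟨j, a, h⟩ := exists_eq_child i; ⟨(j, a), h.symm⟩⟩

lemma tsum_child (f : CellIndex → ENNReal) :
    ∑' i, ∑ a, f (child i a) = ∑' i, f i := by
  rw [← childEquiv.tsum_eq f]
  refine Eq.trans ?_ (ENNReal.tsum_prod' (f := fun x => f (childEquiv x))).symm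
  exact tsum_congr fun i => (tsum_fintype (L := .unconditional _) (fun a => f (child i a))).symm

instance : Countable CellIndex := by
  have : Countable offsets := (Set.countable_range _).to_subtype
  infer_instance

lemma dyadicMap_child (i : CellIndex) (k : ℤ) (a : Fin 3) (x : Plane) :
    dyadicMap (child i a) k x = dyadicMap i (k + 1) (F a x) := by
  simp only [dyadicMap, cellMap, child, F, smul_add, smul_smul]
  rw [zpow_add_one₀ (by norm_num : (2 : ℝ) ≠ 0)]
  have h1 : (2 : ℝ) ^ k * 2 * (((i.1 : ℤ) : ℝ) * 2⁻¹) = 2 ^ k * ((i.1 : ℤ) : ℝ) := by ring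
  have h2 : (2 : ℝ) ^ k * 2 * ((i.1 : ℤ) : ℝ) = 2 ^ k * (((i.1 : ℤ) : ℝ) * 2) := by ring
  rw [h1, h2]
  abel

lemma continuous_dyadicMap (i : CellIndex) (k : ℤ) : Continuous (dyadicMap i k) := by
  unfold dyadicMap cellMap; fun_prop

lemma sign_cases (s : ℤˣ) : ((s : ℤ) : ℝ) = 1 ∨ ((s : ℤ) : ℝ) = -1 := by
  rcases Int.units_eq_one_or s with rfl | rfl <;> simp

lemma dist_dyadicMap (i : CellIndex) (k : ℤ) (x y : Plane) :
    dist (dyadicMap i k x) (dyadicMap i k y) = 2 ^ k * dist x y := by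
  have hs : ‖((i.1 : ℤ) : ℝ)‖ = 1 := by rcases sign_cases i.1 with h | h <;> simp [h]
  rw [dyadicMap, dyadicMap, cellMap, cellMap, dist_smul₀, dist_smul₀, hs, dist_add_right,
    Real.norm_of_nonneg (by positivity), one_mul]

lemma dyadicMap_injective (i : CellIndex) (k : ℤ) : Function.Injective (dyadicMap i k) := by
  intro x y h
  have := dist_dyadicMap i k x y
  rw [h, dist_self, eq_comm, mul_eq_zero] at this
  exact dist_eq_zero.1 (this.resolve_left (by positivity))

lemma half_pow_mem_V {m : ℕ} {x : Plane} (h : x ∈ V m) (K : ℕ) :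
    ((2 : ℝ) ^ K)⁻¹ • x ∈ V (m + K) := by
  induction K with
  | zero => simpa using h
  | succ K ih =>
    have := half_mem_V ih
    rwa [smul_smul, ← mul_inv, ← pow_succ'] at this

lemma signed_zpow_mem_infV (s : ℤˣ) (k : ℤ) {n : ℕ} {x : Plane} (hx : x ∈ V n) :
    ((2 : ℝ) ^ k) • ((s : ℤ) : ℝ) • x ∈ ⋃ m, infV m := by
  have key : ∀ (K m : ℕ) (y : Plane), y ∈ V (m + K) →
      ((2 : ℝ) ^ K) • ((s : ℤ) : ℝ) • y ∈ ⋃ m, infV m := by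
    intro K m y hy
    refine Set.mem_iUnion.2 ⟨m, Set.mem_iUnion.2 ⟨K, _, ?_, rfl⟩⟩
    rcases sign_cases s with h | h
    · left; simpa [h] using hy
    · right; exact ⟨y, hy, by simp [h]⟩
  obtain ⟨K, rfl | rfl⟩ := k.eq_nat_or_neg
  · rw [zpow_natCast]
    exact key K n x (V_mono (Nat.le_add_right _ _) hx)
  · have := key 0 (n + K) _ (half_pow_mem_V hx K)
    rw [pow_zero, one_smul, smul_comm] at this
    rwa [zpow_neg, zpow_natCast]

lemma dyadicMap_coding_mem (i : CellIndex) (k : ℤ) (ω : Addr) :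
    dyadicMap i k (coding ω) ∈ infGasket := by
  induction i using cellIndex_induction generalizing k ω with
  | h0 s =>
    have hω : coding ω ∈ gasket := gasket_eq_range ▸ ⟨ω, rfl⟩
    refine map_mem_closure (continuous_dyadicMap _ _) hω fun x hx => ?_
    obtain ⟨n, hn⟩ := Set.mem_iUnion.1 hx
    simpa [dyadicMap, cellMap, rootCell] using signed_zpow_mem_infV s k hn
  | h1 i a ih =>
    rw [dyadicMap_child, ← coding_cons]
    exact ih _ _

/-- The point with address `ω` in the cell of side `2 ^ k` with label `i`. -/
noncomputable def cellPoint (k : ℤ) (i : CellIndex) (ω : Addr) : infGasket :=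
  ⟨dyadicMap i k (coding ω), dyadicMap_coding_mem i k ω⟩

lemma coe_cellPoint (k : ℤ) (i : CellIndex) (ω : Addr) :
    (cellPoint k i ω : Plane) = dyadicMap i k (coding ω) := rfl

lemma continuous_cellPoint (k : ℤ) (i : CellIndex) : Continuous (cellPoint k i) :=
  ((continuous_dyadicMap i k).comp continuous_coding).subtype_mk _

lemma cellPoint_child (k : ℤ) (i : CellIndex) (a : Fin 3) (ω : Addr) :
    cellPoint k (child i a) ω = cellPoint (k + 1) i (Addr.cons a ω) :=
  Subtype.ext (by rw [coe_cellPoint, coe_cellPoint, dyadicMap_child, coding_cons])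

lemma cellPoint_cons_const_comm (k : ℤ) (i : CellIndex) (a b : Fin 3) :
    cellPoint k i (Addr.cons a (Addr.const b)) = cellPoint k i (Addr.cons b (Addr.const a)) :=
  Subtype.ext (by rw [coe_cellPoint, coe_cellPoint, coding_cons_const_comm])

lemma coding_eq_of_cellPoint_eq {k : ℤ} {i : CellIndex} {ω ω' : Addr}
    (h : cellPoint k i ω = cellPoint k i ω') : coding ω = coding ω' :=
  dyadicMap_injective i k (congrArg Subtype.val h)

lemma dyadicTriangle_eq_range (i : CellIndex) (k : ℤ) :
    dyadicTriangle i k = Set.range (cellPoint k i) := by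
  ext z
  rw [dyadicTriangle, gasket_eq_range, ← Set.range_comp]
  exact ⟨fun ⟨ω, h⟩ => ⟨ω, Subtype.ext h⟩, fun ⟨ω, h⟩ => ⟨ω, congrArg Subtype.val h⟩⟩

lemma isClosed_dyadicTriangle (i : CellIndex) (k : ℤ) : IsClosed (dyadicTriangle i k) := by
  rw [dyadicTriangle_eq_range]
  exact (isCompact_range (continuous_cellPoint k i)).isClosed

/-- For equal signs, the barycentric coordinates of the two coded points differ by integers that are
not both zero, which inside the standard triangle is possible only at corners. For opposite signs,
one cell has nonnegative coordinates and the other nonpositive ones, so they meet at the origin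
only. Stating the conclusion for the address itself uses that corners have a unique address. -/
lemma cell_inter {k : ℤ} {i j : CellIndex} (hij : i ≠ j) {ω ω' : Addr}
    (h : cellPoint k i ω = cellPoint k j ω') : ∃ a, ω = Addr.const a := by
  suffices ∃ a, coding ω = corner a from this.imp fun a ha => coding_eq_corner ha
  have h' : ((i.1 : ℤ) : ℝ) • (coding ω + (i.2 : Plane)) =
      ((j.1 : ℤ) : ℝ) • (coding ω' + (j.2 : Plane)) :=
    smul_right_injective Plane (by positivity : (2 : ℝ) ^ k ≠ 0) (congrArg Subtype.val h)
  have hX := congrArg baryX h'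
  have hY := congrArg baryY h'
  obtain ⟨m, n, hm, hn⟩ := offset_bary i
  obtain ⟨m', n', hm', hn'⟩ := offset_bary j
  simp only [map_add, map_smul, smul_eq_mul, hm, hn, hm', hn'] at hX hY
  obtain ⟨x0, y0, xy1⟩ := bary_coding ω
  obtain ⟨x0', y0', xy1'⟩ := bary_coding ω'
  have hm0 : (0 : ℝ) ≤ m := m.cast_nonneg
  have hn0 : (0 : ℝ) ≤ n := n.cast_nonneg
  have hm0' : (0 : ℝ) ≤ m' := m'.cast_nonneg
  have hn0' : (0 : ℝ) ≤ n' := n'.cast_nonneg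
  have key : ∀ a : Fin 3, (baryX (coding ω) = if a = 1 then 1 else 0) →
      (baryY (coding ω) = if a = 2 then 1 else 0) → ∃ a, coding ω = corner a := fun a h1 h2 =>
    ⟨a, plane_ext (by rw [h1, baryX_corner]) (by rw [h2, baryY_corner])⟩
  by_cases hs : i.1 = j.1
  · have hX' : baryX (coding ω) + m = baryX (coding ω') + m' := by
      rw [hs] at hX
      rcases sign_cases j.1 with h1 | h1 <;> rw [h1] at hX <;> linarith
    have hY' : baryY (coding ω) + n = baryY (coding ω') + n' := by
      rw [hs] at hY
      rcases sign_cases j.1 with h1 | h1 <;> rw [h1] at hY <;> linarith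
    by_cases hmm : m = m'
    · have hnn : n ≠ n' := fun hnn => hij <| cellIndex_ext hs (by rw [hm, hm', hmm])
        (by rw [hn, hn', hnn])
      rcases lt_or_gt_of_ne hnn with hlt | hlt
      · have : (n : ℝ) + 1 ≤ n' := by exact_mod_cast hlt
        exact key 2 (by simp; linarith) (by simp; linarith)
      · have : (n' : ℝ) + 1 ≤ n := by exact_mod_cast hlt
        have hmm' : (m : ℝ) = m' := by rw [hmm]
        exact key 0 (by simp; linarith) (by simp; linarith)
    · rcases lt_or_gt_of_ne hmm with hlt | hlt
      · have : (m : ℝ) + 1 ≤ m' := by exact_mod_cast hlt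
        exact key 1 (by simp; linarith) (by simp; linarith)
      · have h1 : (m' : ℝ) + 1 ≤ m := by exact_mod_cast hlt
        rcases lt_or_ge n n' with hlt' | hlt'
        · have h2 : (n : ℝ) + 1 ≤ n' := by exact_mod_cast hlt'
          exact key 2 (by simp; linarith) (by simp; linarith)
        · have h2 : (n' : ℝ) ≤ n := by exact_mod_cast hlt'
          exact key 0 (by simp; linarith) (by simp; linarith)
  · rcases Int.units_eq_one_or i.1 with h1 | h1 <;> rcases Int.units_eq_one_or j.1 with h2 | h2
    · exact absurd (h1.trans h2.symm) hs
    · rw [h1, h2] at hX hY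
      simp at hX hY
      exact key 0 (by simp; linarith) (by simp; linarith)
    · rw [h1, h2] at hX hY
      simp at hX hY
      exact key 0 (by simp; linarith) (by simp; linarith)
    · exact absurd (h1.trans h2.symm) hs

/-- The corner `a` of the cell of side `2 ^ k` with label `i`. -/
noncomputable def vertex (k : ℤ) (i : CellIndex) (a : Fin 3) : infGasket :=
  cellPoint k i (Addr.const a)

lemma coe_vertex (k : ℤ) (i : CellIndex) (a : Fin 3) :
    (vertex k i a : Plane) = dyadicMap i k (corner a) := by
  rw [vertex, coe_cellPoint, coding_const]

lemma vertex_injective (k : ℤ) (i : CellIndex) : Function.Injective (vertex k i) := by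
  intro a b h
  have := coding_eq_of_cellPoint_eq h
  rw [coding_const, coding_const] at this
  exact corner_injective this

lemma vertex_eq_child (k : ℤ) (i : CellIndex) (a : Fin 3) :
    vertex (k + 1) i a = vertex k (child i a) a := by
  rw [vertex, vertex, cellPoint_child, Addr.cons_const]

lemma vertex_child_comm (k : ℤ) (i : CellIndex) (a b : Fin 3) :
    vertex k (child i a) b = vertex k (child i b) a := by
  rw [vertex, vertex, cellPoint_child, cellPoint_child, cellPoint_cons_const_comm]

lemma eq_of_vertex_eq {k : ℤ} {i j : CellIndex} {a : Fin 3} (hs : i.1 = j.1)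
    (h : vertex k i a = vertex k j a) : i = j := by
  have h' : ((i.1 : ℤ) : ℝ) • (corner a + (i.2 : Plane)) =
      ((j.1 : ℤ) : ℝ) • (corner a + (j.2 : Plane)) := by
    have := congrArg Subtype.val h
    rw [coe_vertex, coe_vertex] at this
    exact smul_right_injective Plane (by positivity : (2 : ℝ) ^ k ≠ 0) this
  have h0 : ((j.1 : ℤ) : ℝ) ≠ 0 := by rcases sign_cases j.1 with h | h <;> rw [h] <;> norm_num
  rw [hs] at h'
  have := add_left_cancel (smul_right_injective Plane h0 h')
  exact Prod.ext hs (Subtype.ext this)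

/-! ### Local finiteness, covering and diameters -/

/-- Barycentric coordinates are bounded on a ball, while translation vectors have natural
coordinates. This gives closedness of the union of all cells and, later, continuity of functions
defined cell by cell. -/
lemma locallyFinite_cells (k : ℤ) :
    LocallyFinite fun i : CellIndex => Set.range fun ω => dyadicMap i k (coding ω) := by
  intro z
  refine ⟨Metric.ball z 1, Metric.ball_mem_nhds z one_pos, ?_⟩
  have h2 : (0 : ℝ) < 2 ^ k := by positivity
  have bound : ∀ (L : Plane →L[ℝ] ℝ), ∃ M : ℝ, ∀ x ∈ Metric.ball z 1, |L x| ≤ 2 ^ k * M := by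
    intro L
    refine ⟨‖L‖ * (‖z‖ + 1) / 2 ^ k, fun x hx => ?_⟩
    rw [mul_div_cancel₀ _ h2.ne']
    refine (L.le_opNorm x).trans (mul_le_mul_of_nonneg_left ?_ (norm_nonneg _))
    have := norm_sub_norm_le x z
    rw [mem_ball_iff_norm] at hx
    linarith
  have coord : ∀ {L : Plane →L[ℝ] ℝ} {M : ℝ} {i : CellIndex} {y : Plane} {m : ℕ}, 0 ≤ L y →
      L (i.2 : Plane) = m → |L (dyadicMap i k y)| ≤ 2 ^ k * M → m ≤ ⌊M⌋₊ := by
    intro L M i y m hy hm h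
    have hs : |((i.1 : ℤ) : ℝ)| = 1 := by rcases sign_cases i.1 with h | h <;> simp [h]
    have hm0 : (0 : ℝ) ≤ m := m.cast_nonneg
    rw [dyadicMap, cellMap, map_smul, map_smul, map_add, smul_eq_mul, smul_eq_mul, abs_mul, abs_mul,
      hs, one_mul, abs_of_pos h2, hm, abs_of_nonneg (by linarith)] at h
    exact Nat.le_floor (by linarith [le_of_mul_le_mul_left h h2])
  obtain ⟨M, hM⟩ := bound baryX
  obtain ⟨N, hN⟩ := bound baryY
  refine Set.Finite.of_injOn (t := (Set.univ : Set ℤˣ) ×ˢ (Set.Iic ⌊M⌋₊ ×ˢ Set.Iic ⌊N⌋₊))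
    (f := fun i : CellIndex => (i.1, ⌊baryX (i.2 : Plane)⌋₊, ⌊baryY (i.2 : Plane)⌋₊)) ?_ ?_
    (Set.finite_univ.prod ((Set.finite_Iic _).prod (Set.finite_Iic _)))
  · rintro i ⟨_, ⟨ω, rfl⟩, hx⟩
    obtain ⟨m, n, hm, hn⟩ := offset_bary i
    obtain ⟨x0, y0, -⟩ := bary_coding ω
    have h1 := coord x0 hm (hM _ hx)
    have h3 := coord y0 hn (hN _ hx)
    simp only [hm, hn, Nat.floor_natCast]
    exact ⟨Set.mem_univ _, h1, h3⟩
  · intro i _ j _ h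
    obtain ⟨m, n, hm, hn⟩ := offset_bary i
    obtain ⟨m', n', hm', hn'⟩ := offset_bary j
    simp only [hm, hn, hm', hn', Nat.floor_natCast, Prod.mk.injEq] at h
    exact cellIndex_ext h.1 (by rw [hm, hm', h.2.1]) (by rw [hn, hn', h.2.2])

lemma locallyFinite_dyadicTriangle (k : ℤ) :
    LocallyFinite fun i : CellIndex => dyadicTriangle i k := by
  have := (locallyFinite_cells k).preimage_continuous
    (continuous_subtype_val (p := fun x => x ∈ infGasket))
  refine this.subset fun i => ?_
  rw [dyadicTriangle_eq_range]
  rintro _ ⟨ω, rfl⟩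
  exact ⟨ω, rfl⟩

lemma exists_cell_succ_iff (k : ℤ) (x : Plane) :
    (∃ i ω, dyadicMap i (k + 1) (coding ω) = x) ↔ ∃ i ω, dyadicMap i k (coding ω) = x := by
  constructor
  · rintro ⟨i, ω, rfl⟩
    exact ⟨child i (ω 0), Addr.tail ω, by rw [dyadicMap_child, ← coding_eq]⟩
  · rintro ⟨i, ω, rfl⟩
    obtain ⟨j, a, rfl⟩ := exists_eq_child i
    exact ⟨j, Addr.cons a ω, by rw [coding_cons, dyadicMap_child]⟩

lemma exists_cell_iff (k l : ℤ) (x : Plane) :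
    (∃ i ω, dyadicMap i k (coding ω) = x) ↔ ∃ i ω, dyadicMap i l (coding ω) = x := by
  have key : ∀ k : ℤ, (∃ i ω, dyadicMap i k (coding ω) = x) ↔
      ∃ i ω, dyadicMap i 0 (coding ω) = x := by
    intro k
    induction k using Int.induction_on with
    | zero => rfl
    | succ n ih => rw [exists_cell_succ_iff, ih]
    | pred n ih => rw [← ih, ← exists_cell_succ_iff, sub_add_cancel]
  rw [key k, key l]

/-- The union of the cells of side `2 ^ k` is the same for all `k`. It contains all vertices, and
local finiteness makes it closed. -/
lemma exists_cellPoint_eq (k : ℤ) (z : infGasket) : ∃ i ω, cellPoint k i ω = z := by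
  have hcl : IsClosed (⋃ i : CellIndex, Set.range fun ω => dyadicMap i k (coding ω)) :=
    (locallyFinite_cells k).isClosed_iUnion fun i =>
      (isCompact_range ((continuous_dyadicMap i k).comp continuous_coding)).isClosed
  have hsub : (⋃ m, infV m) ⊆ ⋃ i : CellIndex, Set.range fun ω => dyadicMap i k (coding ω) := by
    refine Set.iUnion_subset fun m => Set.iUnion_subset fun l => ?_
    have hV : ∀ (s : ℤˣ), ∀ x ∈ V (m + l), ((2 : ℝ) ^ l) • ((s : ℤ) : ℝ) • x ∈
        ⋃ i : CellIndex, Set.range fun ω => dyadicMap i k (coding ω) := by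
      intro s x hx
      rw [V_eq] at hx
      obtain ⟨w, a, -, rfl⟩ := hx
      obtain ⟨i, ω, h⟩ := (exists_cell_iff l k (((2 : ℝ) ^ l) • ((s : ℤ) : ℝ) •
        Fword w (corner a))).1 ⟨rootCell s, Addr.append w (Addr.const a), by
          simp [coding_append, dyadicMap, cellMap, rootCell]⟩
      exact Set.mem_iUnion.2 ⟨i, ω, h⟩
    rintro _ ⟨y, hy | ⟨x, hx, rfl⟩, rfl⟩
    · simpa using hV 1 y hy
    · simpa using hV (-1) x hx
  obtain ⟨i, ω, h⟩ := Set.mem_iUnion.1 (closure_minimal hsub hcl z.2)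
  exact ⟨i, ω, Subtype.ext h⟩

/-- The difference of two coded points is an average of differences of corners, with weights `2 ^
(-(n + 1))` of sum one. -/
lemma dist_coding_le (ω ω' : Addr) : dist (coding ω) (coding ω') ≤ 1 := by
  have hcorner : ∀ a b : Fin 3, dist (corner a) (corner b) ≤ 1 := by
    intro a b
    have h3 : Real.sqrt 3 ^ 2 = 3 := Real.sq_sqrt (by norm_num)
    rw [EuclideanSpace.dist_eq, Real.sqrt_le_one]
    fin_cases a <;> fin_cases b <;> simp [corner, Fin.sum_univ_two, Real.dist_eq] <;>
      norm_num [div_pow, h3]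
  rw [dist_eq_norm, coding, coding, ← (summable_coding ω).tsum_sub (summable_coding ω')]
  have hs : HasSum (fun n : ℕ => (2⁻¹ : ℝ) ^ (n + 1)) 1 := by
    have := (hasSum_geometric_of_lt_one (r := (2⁻¹ : ℝ)) (by norm_num) (by norm_num)).mul_left
      (2⁻¹ : ℝ)
    simpa [pow_succ', show (2⁻¹ : ℝ) * (1 - 2⁻¹)⁻¹ = 1 by norm_num] using this
  refine tsum_of_norm_bounded hs fun n => ?_
  rw [← smul_sub, norm_smul, Real.norm_of_nonneg (by positivity), ← dist_eq_norm]
  exact mul_le_of_le_one_right (by positivity) (hcorner _ _)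

lemma diam_dyadicTriangle (i : CellIndex) (k : ℤ) : Metric.diam (dyadicTriangle i k) = 2 ^ k := by
  rw [dyadicTriangle_eq_range]
  have hd : ∀ ω ω', dist (cellPoint k i ω) (cellPoint k i ω') =
      2 ^ k * dist (coding ω) (coding ω') := fun ω ω' => dist_dyadicMap i k _ _
  apply le_antisymm
  · refine Metric.diam_le_of_forall_dist_le (by positivity) ?_
    rintro _ ⟨ω, rfl⟩ _ ⟨ω', rfl⟩
    rw [hd]
    exact mul_le_of_le_one_right (by positivity) (dist_coding_le _ _)
  · have hb : Bornology.IsBounded (Set.range (cellPoint k i)) :=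
      (isCompact_range (continuous_cellPoint k i)).isBounded
    have := Metric.dist_le_diam_of_mem hb ⟨Addr.const 0, rfl⟩ ⟨Addr.const 1, rfl⟩
    rw [hd, coding_const, coding_const] at this
    have h1 : dist (corner 0) (corner 1) = 1 := by
      rw [EuclideanSpace.dist_eq]
      simp [corner, Fin.sum_univ_two, Real.dist_eq]
    rwa [h1, mul_one] at this

/-! ### The Hausdorff measure -/

/-- The uniform Bernoulli measure on the space of addresses. -/
noncomputable def bernoulli : Measure Addr :=
  Measure.infinitePi fun _ : ℕ => (PMF.uniformOfFintype (Fin 3)).toMeasure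

instance : IsProbabilityMeasure bernoulli := by unfold bernoulli; infer_instance

lemma measurable_cons (a : Fin 3) : Measurable (Addr.cons a) :=
  measurable_pi_lambda _ fun n => by
    cases n with
    | zero => exact measurable_const
    | succ n => exact measurable_pi_apply n

/-- Self-similarity under conditioning on the first letter. By uniqueness of product measures it
suffices to compare boxes, and padding a box to an initial segment of the coordinates lets the
zeroth factor be split off. -/
lemma bernoulli_eq_sum : bernoulli = ∑ a, (3⁻¹ : ENNReal) • bernoulli.map (Addr.cons a) := by
  symm
  refine Measure.eq_infinitePi _ fun s t ht => ?_
  classical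
  obtain ⟨N, hN⟩ : ∃ N, s ⊆ Finset.range (N + 1) :=
    ⟨s.sup id, fun n hn => Finset.mem_range_succ_iff.2 (Finset.le_sup (f := id) hn)⟩
  set t' : ℕ → Set (Fin 3) := fun n => if n ∈ s then t n else Set.univ with ht'
  have hpi : Set.pi s t = Set.pi (Finset.range (N + 1)) t' := by
    ext ω
    simp only [Set.mem_pi, Finset.mem_coe, ht']
    constructor
    · intro h n _
      by_cases hn : n ∈ s
      · simpa [hn] using h n hn
      · simp [hn]
    · intro h n hn
      simpa [hn] using h n (hN hn)
  have hprod : ∏ n ∈ s, (PMF.uniformOfFintype (Fin 3)).toMeasure (t n) =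
      ∏ n ∈ Finset.range (N + 1), (PMF.uniformOfFintype (Fin 3)).toMeasure (t' n) := by
    rw [← Finset.prod_subset hN (f := fun n => (PMF.uniformOfFintype (Fin 3)).toMeasure (t' n))
      fun n _ hn => by simp [ht', hn]]
    exact Finset.prod_congr rfl fun n hn => by simp [ht', hn]
  have hpre : ∀ a, Addr.cons a ⁻¹' Set.pi (Finset.range (N + 1)) t' =
      if a ∈ t' 0 then Set.pi (Finset.range N) (fun n => t' (n + 1)) else ∅ := by
    intro a
    ext ω
    by_cases ha : a ∈ t' 0
    · simp only [ha, if_true, Set.mem_preimage, Set.mem_pi, Finset.mem_coe, Finset.mem_range]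
      refine ⟨fun h n hn => h (n + 1) (by omega), fun h n hn => ?_⟩
      cases n with
      | zero => exact ha
      | succ n => exact h n (by omega)
    · simp only [ha, if_false, Set.mem_preimage, Set.mem_pi, Finset.mem_coe, Finset.mem_range,
        Set.mem_empty_iff_false, iff_false]
      exact fun h => ha (h 0 (by omega))
  have hmeas : MeasurableSet (Set.pi (Finset.range (N + 1) : Set ℕ) t') :=
    MeasurableSet.pi (Finset.countable_toSet _) fun _ _ => MeasurableSet.of_discrete
  rw [hpi, hprod, Finset.prod_range_succ', PMF.toMeasure_apply_fintype, Measure.finsetSum_apply,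
    mul_comm, Finset.sum_mul]
  refine Finset.sum_congr rfl fun a _ => ?_
  rw [Measure.smul_apply, Measure.map_apply (measurable_cons a) hmeas, hpre, smul_eq_mul]
  by_cases ha : a ∈ t' 0
  · rw [if_pos ha, bernoulli, Measure.infinitePi_pi _ fun _ _ => MeasurableSet.of_discrete]
    simp [ha]
  · simp [ha]

lemma bernoulli_apply {s : Set Addr} (hs : MeasurableSet s) :
    bernoulli s = 3⁻¹ * ∑ a, bernoulli (Addr.cons a ⁻¹' s) := by
  conv_lhs => rw [bernoulli_eq_sum]
  rw [Measure.finsetSum_apply, Finset.mul_sum]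
  exact Finset.sum_congr rfl fun a _ => by
    rw [Measure.smul_apply, Measure.map_apply (measurable_cons a) hs, smul_eq_mul]

/-- By self-similarity the mass of this point equals a third of itself, and it is finite. -/
lemma bernoulli_const (a : Fin 3) : bernoulli {Addr.const a} = 0 := by
  have hpre : ∀ b, Addr.cons b ⁻¹' {Addr.const a} = if b = a then {Addr.const a} else ∅ := by
    intro b
    ext ω
    by_cases hb : b = a
    · subst hb
      rw [if_pos rfl, Set.mem_preimage, Set.mem_singleton_iff, Set.mem_singleton_iff]
      exact ⟨fun h => congrArg Addr.tail h, fun h => by rw [h, Addr.cons_const]⟩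
    · rw [if_neg hb]
      exact iff_of_false (fun h => hb (congrFun h 0)) (Set.notMem_empty _)
  have h := bernoulli_apply (MeasurableSet.singleton (Addr.const a))
  simp only [hpre, apply_ite bernoulli, measure_empty, Finset.sum_ite_eq', Finset.mem_univ,
    if_true] at h
  by_contra h0
  have hlt : (3⁻¹ : ENNReal) * bernoulli {Addr.const a} < 1 * bernoulli {Addr.const a} :=
    ENNReal.mul_lt_mul_left h0 (measure_ne_top _ _) (by norm_num)
  rw [one_mul, ← h] at hlt
  exact lt_irrefl _ hlt

lemma measurable_cellPoint (k : ℤ) (i : CellIndex) : Measurable (cellPoint k i) :=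
  (continuous_cellPoint k i).measurable

/-- The sum of the images of the Bernoulli measure on all cells of side `2 ^ k`. -/
noncomputable def cellSum (k : ℤ) : Measure infGasket :=
  Measure.sum fun i => bernoulli.map (cellPoint k i)

lemma cellSum_apply (k : ℤ) {s : Set infGasket} (hs : MeasurableSet s) :
    cellSum k s = ∑' i, bernoulli (cellPoint k i ⁻¹' s) := by
  rw [cellSum, Measure.sum_apply _ hs]
  exact tsum_congr fun i => Measure.map_apply (measurable_cellPoint k i) hs

lemma cellSum_eq (k : ℤ) : cellSum k = (3 : ENNReal) • cellSum (k + 1) := by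
  ext s hs
  rw [Measure.smul_apply, cellSum_apply k hs, cellSum_apply (k + 1) hs, smul_eq_mul,
    ← ENNReal.tsum_mul_left, ← tsum_child]
  refine tsum_congr fun i => ?_
  rw [bernoulli_apply (measurable_cellPoint (k + 1) i hs), ← mul_assoc,
    ENNReal.mul_inv_cancel (by norm_num) (by norm_num), one_mul]
  refine Finset.sum_congr rfl fun a _ => ?_
  congr 1
  ext ω
  simp only [Set.mem_preimage, cellPoint_child]

lemma isClosed_infGasket : IsClosed infGasket := isClosed_closure

lemma infMeasure_eq_cellSum_zero : infMeasure = cellSum 0 := by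
  have hemb := MeasurableEmbedding.subtype_coe isClosed_infGasket.measurableSet
  ext s hs
  have hs' := hemb.measurableSet_image.2 hs
  rw [infMeasure, hemb.comap_apply, Measure.sum_apply _ hs', cellSum_apply 0 hs]
  refine tsum_congr fun i => ?_
  have hc : Continuous (cellMap i) := by unfold cellMap; fun_prop
  rw [Measure.map_apply hc.measurable hs', gasketMeasure,
    Measure.map_apply continuous_coding.measurable (hc.measurable hs'), ← bernoulli]
  congr 1
  ext ω
  have : cellMap i (coding ω) = (cellPoint 0 i ω : Plane) := by
    rw [coe_cellPoint, dyadicMap, zpow_zero, one_smul]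
  simp only [Set.mem_preimage, this]
  exact Subtype.val_injective.mem_set_image

/-- The measure is defined through cells of side one; splitting cells into their three children
carries that description to every scale. -/
lemma infMeasure_eq (k : ℤ) : infMeasure = (3 : ENNReal) ^ (k : ℝ) • cellSum k := by
  have h3 : (3 : ENNReal) ≠ 0 := by norm_num
  have h3' : (3 : ENNReal) ≠ ⊤ := by norm_num
  have step : ∀ k : ℤ, (3 : ENNReal) ^ (k : ℝ) • cellSum k =
      (3 : ENNReal) ^ ((k + 1 : ℤ) : ℝ) • cellSum (k + 1) := by
    intro k
    rw [cellSum_eq k, smul_smul, Int.cast_add, Int.cast_one, ENNReal.rpow_add _ _ h3 h3',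
      ENNReal.rpow_one]
  induction k using Int.induction_on with
  | zero => simp [infMeasure_eq_cellSum_zero]
  | succ n ih => rw [ih, step]
  | pred n ih => rw [ih, step (-(n : ℤ) - 1), sub_add_cancel]

lemma infMeasure_dyadicTriangle (i : CellIndex) (k : ℤ) :
    infMeasure (dyadicTriangle i k) = (3 : ENNReal) ^ (k : ℝ) := by
  rw [infMeasure_eq k, Measure.smul_apply,
    cellSum_apply k (isClosed_dyadicTriangle i k).measurableSet, dyadicTriangle_eq_range,
    tsum_eq_single i, Set.preimage_range, measure_univ, smul_eq_mul, mul_one]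
  intro j hj
  refine measure_mono_null (t := ⋃ a, {Addr.const a}) ?_
    (measure_iUnion_null fun a => bernoulli_const a)
  rintro ω ⟨ω', h⟩
  obtain ⟨a, ha⟩ := cell_inter hj h.symm
  exact Set.mem_iUnion.2 ⟨a, ha⟩

/-! ### Energies on cells -/

/-- The unnormalised energy of `u` on the corners of the cell of side `2 ^ k` with label `i`. -/
noncomputable def edgeEnergy (u : infGasket → ℝ) (k : ℤ) (i : CellIndex) : ENNReal :=
  ∑ a, ∑ b, ENNReal.ofReal ((u (vertex k i a) - u (vertex k i b)) ^ 2)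

/-- The sum of the unnormalised energies on all cells of side `2 ^ k`. -/
noncomputable def totalEnergy (u : infGasket → ℝ) (k : ℤ) : ENNReal := ∑' i, edgeEnergy u k i

lemma edgeEnergy_eq_ofReal (u : infGasket → ℝ) (k : ℤ) (i : CellIndex) :
    edgeEnergy u k i = ENNReal.ofReal (∑ a, ∑ b, (u (vertex k i a) - u (vertex k i b)) ^ 2) := by
  rw [ENNReal.ofReal_sum_of_nonneg fun a _ => Finset.sum_nonneg fun b _ => sq_nonneg _]
  exact Finset.sum_congr rfl fun a _ =>
    (ENNReal.ofReal_sum_of_nonneg fun b _ => sq_nonneg _).symm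

/-- For given corner values the energy of the three subcells is least when the midpoint values
follow the 2/5–2/5–1/5 rule, and then equality holds. The squares below measure the deviation from
that minimiser. -/
lemma edgeEnergy_succ_le (u : infGasket → ℝ) (k : ℤ) (i : CellIndex) :
    edgeEnergy u (k + 1) i ≤ ENNReal.ofReal (5 / 3) * ∑ c, edgeEnergy u k (child i c) := by
  simp only [edgeEnergy_eq_ofReal]
  rw [← ENNReal.ofReal_sum_of_nonneg fun c _ => Finset.sum_nonneg fun a _ =>
      Finset.sum_nonneg fun b _ => sq_nonneg _, ← ENNReal.ofReal_mul (by norm_num)]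
  refine ENNReal.ofReal_le_ofReal ?_
  simp only [Fin.sum_univ_three, vertex_eq_child]
  rw [vertex_child_comm k i 1 0, vertex_child_comm k i 2 0, vertex_child_comm k i 2 1]
  generalize u (vertex k (child i 0) 0) = p
  generalize u (vertex k (child i 1) 1) = q
  generalize u (vertex k (child i 2) 2) = r
  generalize u (vertex k (child i 0) 1) = x
  generalize u (vertex k (child i 1) 2) = y
  generalize u (vertex k (child i 0) 2) = z
  have hx := sq_nonneg (x - (2 * p + 2 * q + r) / 5)
  have hy := sq_nonneg (y - (p + 2 * q + 2 * r) / 5)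
  have hz := sq_nonneg (z - (2 * p + q + 2 * r) / 5)
  have hxy := sq_nonneg ((x - (2 * p + 2 * q + r) / 5) - (y - (p + 2 * q + 2 * r) / 5))
  have hyz := sq_nonneg ((y - (p + 2 * q + 2 * r) / 5) - (z - (2 * p + q + 2 * r) / 5))
  have hxz := sq_nonneg ((x - (2 * p + 2 * q + r) / 5) - (z - (2 * p + q + 2 * r) / 5))
  linarith

lemma totalEnergy_succ_le (u : infGasket → ℝ) (k : ℤ) :
    totalEnergy u (k + 1) ≤ ENNReal.ofReal (5 / 3) * totalEnergy u k := by
  rw [totalEnergy, totalEnergy, ← tsum_child (edgeEnergy u k), ← ENNReal.tsum_mul_left]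
  exact ENNReal.tsum_le_tsum fun i => edgeEnergy_succ_le u k i

lemma totalEnergy_add_le (u : infGasket → ℝ) (k : ℤ) (n : ℕ) :
    totalEnergy u (k + n) ≤ ENNReal.ofReal ((5 / 3) ^ n) * totalEnergy u k := by
  induction n with
  | zero => simp
  | succ n ih =>
    rw [Nat.cast_succ, ← add_assoc]
    refine (totalEnergy_succ_le u _).trans ((mul_le_mul_right ih _).trans_eq ?_)
    rw [← mul_assoc, ← ENNReal.ofReal_mul (by norm_num), pow_succ']

lemma totalEnergy_eq_tsum (u : infGasket → ℝ) (k : ℤ) :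
    totalEnergy u k = ∑' x : CellIndex × Fin 3 × Fin 3,
      ENNReal.ofReal ((u (vertex k x.1 x.2.1) - u (vertex k x.1 x.2.2)) ^ 2) := by
  refine Eq.trans ?_ (ENNReal.tsum_prod' (f := fun x : CellIndex × Fin 3 × Fin 3 =>
    ENNReal.ofReal ((u (vertex k x.1 x.2.1) - u (vertex k x.1 x.2.2)) ^ 2))).symm
  refine tsum_congr fun i => ?_
  rw [tsum_fintype, Fintype.sum_prod_type]
  rfl

lemma levelEnergy_eq (m : ℕ) (u : infGasket → ℝ) :
    levelEnergy m u = ENNReal.ofReal (2⁻¹ * (5 / 3) ^ m) *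
      ∑' e : {e : infGasket × infGasket // Neighbours m e.1 e.2},
        ENNReal.ofReal ((u e.1.1 - u e.1.2) ^ 2) := by
  rw [levelEnergy, ← ENNReal.tsum_mul_left]
  exact tsum_congr fun e => ENNReal.ofReal_mul (by positivity)

lemma neighbours_iff (m : ℕ) (x y : infGasket) : Neighbours m x y ↔
    ∃ i a b, a ≠ b ∧ vertex (-m) i a = x ∧ vertex (-m) i b = y := by
  constructor
  · rintro ⟨hne, i, ⟨_, ⟨a, rfl⟩, hx⟩, _, ⟨b, rfl⟩, hy⟩
    have hx' : vertex (-m) i a = x := Subtype.ext (by rw [coe_vertex, hx])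
    have hy' : vertex (-m) i b = y := Subtype.ext (by rw [coe_vertex, hy])
    refine ⟨i, a, b, ?_, hx', hy'⟩
    rintro rfl
    exact hne (hx'.symm.trans hy')
  · rintro ⟨i, a, b, hab, rfl, rfl⟩
    exact ⟨fun h => hab (vertex_injective _ _ h), i, ⟨_, ⟨a, rfl⟩, (coe_vertex _ _ _).symm⟩,
      _, ⟨b, rfl⟩, (coe_vertex _ _ _).symm⟩

lemma levelEnergy_le (m : ℕ) (u : infGasket → ℝ) :
    levelEnergy m u ≤ ENNReal.ofReal (2⁻¹ * (5 / 3) ^ m) * totalEnergy u (-m) := by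
  rw [levelEnergy_eq, totalEnergy_eq_tsum]
  refine mul_le_mul_right ?_ _
  choose i a b _ ha hb using fun e : {e : infGasket × infGasket // Neighbours m e.1 e.2} =>
    (neighbours_iff m e.1.1 e.1.2).1 e.2
  have hinj : Function.Injective fun e => (i e, a e, b e) := by
    intro e e' h
    simp only [Prod.mk.injEq] at h
    refine Subtype.ext (Prod.ext ?_ ?_)
    · rw [← ha e, ← ha e', h.1, h.2.1]
    · rw [← hb e, ← hb e', h.1, h.2.2]
  refine le_trans (le_of_eq (tsum_congr fun e => ?_)) (ENNReal.tsum_comp_le_tsum_of_injective hinj _)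
  simp only [ha e, hb e]

/-- A pair of neighbours might come from several cells, but the sign of a cell and the label of the
corner at the first point determine the cell. This leaves at most `2 * 3 = 6` possibilities. -/
lemma totalEnergy_neg_le (m : ℕ) (u : infGasket → ℝ) :
    ENNReal.ofReal (2⁻¹ * (5 / 3) ^ m) * totalEnergy u (-m) ≤ 6 * levelEnergy m u := by
  rw [levelEnergy_eq, mul_left_comm]
  refine mul_le_mul_right ?_ _
  set g : infGasket × infGasket → ENNReal := fun e => ENNReal.ofReal ((u e.1 - u e.2) ^ 2) with hg
  have hsum : (6 : ENNReal) * ∑' e : {e : infGasket × infGasket // Neighbours m e.1 e.2}, g e =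
      ∑' x : {e : infGasket × infGasket // Neighbours m e.1 e.2} × ℤˣ × Fin 3, g x.1 := by
    rw [ENNReal.tsum_prod' (f := fun x : {e : infGasket × infGasket // Neighbours m e.1 e.2} ×
      ℤˣ × Fin 3 => g x.1), ← ENNReal.tsum_mul_left]
    refine tsum_congr fun e => ?_
    rw [tsum_fintype]
    change 6 * g e = ∑ _b : ℤˣ × Fin 3, g e
    rw [Finset.sum_const, nsmul_eq_mul, show (Finset.univ : Finset (ℤˣ × Fin 3)).card = 6 from rfl]
    norm_num
  change _ ≤ 6 * ∑' e : {e : infGasket × infGasket // Neighbours m e.1 e.2}, g e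
  rw [hsum, totalEnergy_eq_tsum]
  have hsupp : (Function.support fun x : CellIndex × Fin 3 × Fin 3 =>
      g (vertex (-m) x.1 x.2.1, vertex (-m) x.1 x.2.2)) ⊆ {x | x.2.1 ≠ x.2.2} := by
    intro x hx h
    simp [hg, h] at hx
  change ∑' x : CellIndex × Fin 3 × Fin 3,
      g (vertex (-m) x.1 x.2.1, vertex (-m) x.1 x.2.2) ≤ _
  rw [← tsum_subtype_eq_of_support_subset hsupp]
  let φ : {x : CellIndex × Fin 3 × Fin 3 | x.2.1 ≠ x.2.2} →
      {e : infGasket × infGasket // Neighbours m e.1 e.2} × ℤˣ × Fin 3 := fun x =>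
    (⟨(vertex (-m) x.1.1 x.1.2.1, vertex (-m) x.1.1 x.1.2.2),
      (neighbours_iff _ _ _).2 ⟨_, _, _, x.2, rfl, rfl⟩⟩, x.1.1.1, x.1.2.1)
  have hφ : Function.Injective φ := by
    rintro ⟨⟨i, a, b⟩, hab⟩ ⟨⟨j, c, d⟩, hcd⟩ h
    simp only [φ, Prod.mk.injEq, Subtype.mk.injEq] at h
    obtain ⟨⟨h1, h2⟩, hs, rfl⟩ := h
    obtain rfl := eq_of_vertex_eq hs h1
    obtain rfl := vertex_injective _ _ h2
    rfl
  exact ENNReal.tsum_comp_le_tsum_of_injective hφ fun x => g x.1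

/-- For scales at most one this is the definition of the energy, with `12 = 6 * 2` from the overlap
count and the factor `1/2`. Coarser scales follow because renormalised energies decrease under
coarsening. -/
lemma totalEnergy_le (u : infGasket → ℝ) (k : ℤ) :
    totalEnergy u k ≤ ENNReal.ofReal (12 * (5 / 3) ^ k) * energy u := by
  have hneg : ∀ m : ℕ, totalEnergy u (-m) ≤ ENNReal.ofReal (12 * (5 / 3) ^ (-m : ℤ)) * energy u := by
    intro m
    have hc : (0 : ℝ) < 2⁻¹ * (5 / 3) ^ m := by positivity
    have h := (totalEnergy_neg_le m u).trans (mul_le_mul_right (le_iSup (levelEnergy · u) m) _)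
    have h2 := mul_le_mul_right h (ENNReal.ofReal (2⁻¹ * (5 / 3) ^ m)⁻¹)
    rw [← mul_assoc, ← ENNReal.ofReal_mul (by positivity), inv_mul_cancel₀ hc.ne',
      ENNReal.ofReal_one, one_mul, ← mul_assoc] at h2
    refine h2.trans_eq ?_
    congr 1
    rw [show (6 : ENNReal) = ENNReal.ofReal 6 by simp, ← ENNReal.ofReal_mul (by positivity)]
    congr 1
    rw [zpow_neg, zpow_natCast, mul_inv, inv_inv]; ring
  obtain ⟨m, rfl | rfl⟩ := k.eq_nat_or_neg
  · have h := totalEnergy_add_le u 0 m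
    have h0 := hneg 0
    simp only [Nat.cast_zero, neg_zero, zpow_zero, mul_one, zero_add] at h h0
    refine h.trans ((mul_le_mul_right h0 _).trans_eq ?_)
    rw [← mul_assoc, ← ENNReal.ofReal_mul (by positivity), mul_comm (12 : ℝ), zpow_natCast]
  · exact hneg m

/-! ### Oscillation on cells -/

/-- The sum of the unnormalised energies on the subcells of generation `j`. -/
noncomputable def depthEnergy (u : infGasket → ℝ) : ℕ → ℤ → CellIndex → ENNReal
  | 0, k, i => edgeEnergy u k i
  | j + 1, k, i => ∑ a, depthEnergy u j (k - 1) (child i a)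

lemma tsum_depthEnergy (u : infGasket → ℝ) (j : ℕ) (k : ℤ) :
    ∑' i, depthEnergy u j k i = totalEnergy u (k - j) := by
  induction j generalizing k with
  | zero => simp [depthEnergy, totalEnergy]
  | succ j ih =>
    simp only [depthEnergy]
    rw [tsum_child (depthEnergy u j (k - 1)), ih]
    congr 1; push_cast; ring

lemma sq_enorm_eq_ofReal (x : ℝ) : ‖x‖ₑ ^ 2 = ENNReal.ofReal (x ^ 2) := by
  rw [Real.enorm_eq_ofReal_abs, ← ENNReal.ofReal_pow (abs_nonneg x), sq_abs]

lemma sq_enorm_sub_vertex_le (u : infGasket → ℝ) (k : ℤ) (i : CellIndex) (a b : Fin 3) :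
    ‖u (vertex k i a) - u (vertex k i b)‖ₑ ^ 2 ≤ edgeEnergy u k i := by
  rw [sq_enorm_eq_ofReal]
  exact (Finset.single_le_sum (f := fun b => ENNReal.ofReal ((u (vertex k i a) -
    u (vertex k i b)) ^ 2)) (fun _ _ => zero_le) (Finset.mem_univ b)).trans
    (Finset.single_le_sum (f := fun a => ∑ b, ENNReal.ofReal ((u (vertex k i a) -
    u (vertex k i b)) ^ 2)) (fun _ _ => zero_le) (Finset.mem_univ a))

/-- Consecutive truncations are two corners of one subcell of generation `j + 1`, so a single edge
of that generation carries the increment. -/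
lemma sq_enorm_sub_trunc_le (u : infGasket → ℝ) (j : ℕ) (k : ℤ) (i : CellIndex) (ω : Addr) :
    ‖u (cellPoint k i (ω.trunc (j + 1))) - u (cellPoint k i (ω.trunc j))‖ₑ ^ 2 ≤
      depthEnergy u (j + 1) k i := by
  induction j generalizing k i ω with
  | zero =>
    -- The point `ω₀ 0 0 …` is also `0 ω₀ ω₀ …`, hence a corner of the same subcell as the corner `0
    -- 0 0 …`.
    have h1 : cellPoint k i (ω.trunc 1) = vertex (k - 1) (child i 0) (ω 0) := by
      rw [Addr.trunc_succ, Addr.trunc_zero, cellPoint_cons_const_comm, vertex, cellPoint_child,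
        sub_add_cancel]
    have h2 : cellPoint k i (ω.trunc 0) = vertex (k - 1) (child i 0) 0 := by
      rw [Addr.trunc_zero, vertex, cellPoint_child, sub_add_cancel, Addr.cons_const]
    rw [zero_add, h1, h2]
    refine (sq_enorm_sub_vertex_le u _ _ _ _).trans ?_
    exact Finset.single_le_sum (f := fun a => edgeEnergy u (k - 1) (child i a))
      (fun _ _ => zero_le) (Finset.mem_univ 0)
  | succ j ih =>
    have h : ∀ n, cellPoint k i (ω.trunc (n + 1)) =
        cellPoint (k - 1) (child i (ω 0)) (Addr.trunc (Addr.tail ω) n) := fun n => by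
      rw [Addr.trunc_succ, cellPoint_child, sub_add_cancel]
    rw [h, h]
    refine (ih (k - 1) (child i (ω 0)) _).trans ?_
    exact Finset.single_le_sum (f := fun a => depthEnergy u (j + 1) (k - 1) (child i a))
      (fun _ _ => zero_le) (Finset.mem_univ (ω 0))

/-- A bound for the squared oscillation of `u` on the cell of side `2 ^ k` with label `i`. -/
noncomputable def oscBound (u : infGasket → ℝ) (k : ℤ) (i : CellIndex) : ENNReal :=
  25 * ∑' j : ℕ, ENNReal.ofReal ((25 / 16) ^ j) * depthEnergy u (j + 1) k i

/-- Chaining along the truncations of `ω`. The weight `25/16 = (5/4) ^ 2` makes the increments decay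
like `(4/5) ^ j`, whose sum is `5`, whence the factor `25`; it stays below `5/3`, so the weighted
energies are still summable. -/
lemma sq_enorm_sub_le_oscBound {u : infGasket → ℝ} (hu : Continuous u) (k : ℤ) (i : CellIndex)
    (ω : Addr) : ‖u (cellPoint k i ω) - u (vertex k i 0)‖ₑ ^ 2 ≤ oscBound u k i := by
  rw [oscBound]
  set B := ∑' j : ℕ, ENNReal.ofReal ((25 / 16) ^ j) * depthEnergy u (j + 1) k i with hB
  rcases eq_or_ne B ⊤ with h | hfin
  · rw [h, ENNReal.mul_top (by norm_num)]; exact le_top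
  have hstep : ∀ j, dist (u (cellPoint k i (ω.trunc j))) (u (cellPoint k i (ω.trunc (j + 1)))) ≤
      Real.sqrt B.toReal * (4 / 5) ^ j := by
    intro j
    have h1 := (mul_le_mul_right (sq_enorm_sub_trunc_le u j k i ω)
      (ENNReal.ofReal ((25 / 16) ^ j))).trans (ENNReal.le_tsum (f := fun j : ℕ =>
        ENNReal.ofReal ((25 / 16) ^ j) * depthEnergy u (j + 1) k i) j)
    rw [← hB, sq_enorm_eq_ofReal, ← ENNReal.ofReal_mul (by positivity),
      ENNReal.ofReal_le_iff_le_toReal hfin] at h1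
    rw [dist_comm, Real.dist_eq]
    refine abs_le_of_sq_le_sq ?_ (by positivity)
    rw [mul_pow, Real.sq_sqrt ENNReal.toReal_nonneg, ← pow_mul, mul_comm j, pow_mul]
    have h2 := mul_le_mul_of_nonneg_right h1 (by positivity : (0 : ℝ) ≤ ((4 / 5) ^ 2) ^ j)
    rwa [mul_right_comm, ← mul_pow, show (25 / 16 : ℝ) * (4 / 5) ^ 2 = 1 by norm_num, one_pow,
      one_mul] at h2
  have hlim : Tendsto (fun n => u (cellPoint k i (ω.trunc n))) atTop (𝓝 (u (cellPoint k i ω))) :=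
    ((hu.comp (continuous_cellPoint k i)).tendsto ω).comp (Addr.tendsto_trunc ω)
  have hd := dist_le_of_le_geometric_of_tendsto₀ (4 / 5) _ (by norm_num) hstep hlim
  rw [Addr.trunc_zero, ← vertex, dist_comm, Real.dist_eq] at hd
  rw [sq_enorm_eq_ofReal, ← ENNReal.ofReal_toReal hfin,
    show (25 : ENNReal) = ENNReal.ofReal 25 by simp, ← ENNReal.ofReal_mul (by norm_num)]
  refine ENNReal.ofReal_le_ofReal ?_
  rw [← sq_abs]
  refine (pow_le_pow_left₀ (abs_nonneg _) hd 2).trans_eq ?_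
  rw [div_pow, Real.sq_sqrt ENNReal.toReal_nonneg]; ring

/-- Generation `j + 1` contributes at most `12 (5/3) ^ (k - j - 1)` times the energy; against the
weight this is geometric with ratio `25/16 * 3/5 = 15/16`. The constant is `25 * 12 * (3/5) * 16`.
-/
lemma tsum_oscBound_le (u : infGasket → ℝ) (k : ℤ) :
    ∑' i, oscBound u k i ≤ ENNReal.ofReal (2880 * (5 / 3) ^ k) * energy u := by
  simp only [oscBound]
  rw [ENNReal.tsum_mul_left, ENNReal.tsum_comm]
  simp only [ENNReal.tsum_mul_left, tsum_depthEnergy]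
  have hj : ∀ j : ℕ, ENNReal.ofReal ((25 / 16) ^ j) * totalEnergy u (k - (j + 1 : ℕ)) ≤
      ENNReal.ofReal ((15 / 16) ^ j) * (ENNReal.ofReal (12 * (3 / 5) * (5 / 3) ^ k) * energy u) := by
    intro j
    refine (mul_le_mul_right (totalEnergy_le u _) _).trans_eq ?_
    rw [← mul_assoc, ← mul_assoc, ← ENNReal.ofReal_mul (by positivity),
      ← ENNReal.ofReal_mul (by positivity)]
    congr 2
    rw [zpow_sub₀ (by norm_num), zpow_natCast, show (15 / 16 : ℝ) = 25 / 16 * (3 / 5) by norm_num,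
      mul_pow, show (3 / 5 : ℝ) = (5 / 3)⁻¹ by norm_num, pow_succ, inv_pow]
    field_simp
  refine (mul_le_mul_right (ENNReal.tsum_le_tsum hj) _).trans_eq ?_
  rw [ENNReal.tsum_mul_right, ← ENNReal.ofReal_tsum_of_nonneg (fun _ => by positivity)
    (summable_geometric_of_lt_one (by norm_num) (by norm_num)),
    tsum_geometric_of_lt_one (by norm_num) (by norm_num),
    show (25 : ENNReal) = ENNReal.ofReal 25 by simp, ← mul_assoc, ← mul_assoc,
    ← ENNReal.ofReal_mul (by norm_num), ← ENNReal.ofReal_mul (by norm_num)]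
  congr 2
  ring

/-! ### Summation over cells -/

/-- If `z` lies in more than one cell, it is a corner of each of them, and a cell is determined by
its sign and the label of the corner at `z`. -/
lemma tsum_indicator_dyadicTriangle_le (k : ℤ) (z : infGasket) :
    ∑' i : CellIndex, (dyadicTriangle i k).indicator (fun _ => (1 : ENNReal)) z ≤ 6 := by
  classical
  set A : Set CellIndex := {i | z ∈ dyadicTriangle i k} with hA
  have hex : ∀ i : A, ∃ a, vertex k i a = z ∨ A.Subsingleton := by
    rintro ⟨i, hi⟩
    by_cases hsub : A.Subsingleton
    · exact ⟨0, Or.inr hsub⟩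
    · obtain ⟨j, hj, hji⟩ := (Set.not_subsingleton_iff.1 hsub).exists_ne i
      rw [hA, Set.mem_ofPred_eq, dyadicTriangle_eq_range] at hi hj
      obtain ⟨ω, hω⟩ := hi
      obtain ⟨ω', hω'⟩ := hj
      obtain ⟨a, rfl⟩ := cell_inter hji.symm (hω.trans hω'.symm)
      exact ⟨a, Or.inl hω⟩
  choose a ha using hex
  have hinj : Function.Injective fun i : A => (i.1.1, a i) := by
    intro i j h
    simp only [Prod.mk.injEq] at h
    rcases ha i with h1 | h1
    · rcases ha j with h2 | h2
      · rw [← h.2] at h2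
        exact Subtype.ext (eq_of_vertex_eq h.1 (h1.trans h2.symm))
      · exact Subtype.ext (h2 i.2 j.2)
    · exact Subtype.ext (h1 i.2 j.2)
  calc ∑' i : CellIndex, (dyadicTriangle i k).indicator (fun _ => (1 : ENNReal)) z
      = ∑' i : CellIndex, A.indicator (fun _ => (1 : ENNReal)) i := rfl
    _ = ∑' i : A, (1 : ENNReal) := (tsum_subtype A _).symm
    _ ≤ ∑' _ : ℤˣ × Fin 3, (1 : ENNReal) :=
        ENNReal.tsum_comp_le_tsum_of_injective hinj fun _ => (1 : ENNReal)
    _ = 6 := by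
        rw [tsum_fintype, Finset.sum_const, nsmul_eq_mul,
          show (Finset.univ : Finset (ℤˣ × Fin 3)).card = 6 from rfl]
        norm_num

lemma tsum_setLIntegral_dyadicTriangle_le (σ : Measure infGasket) (k : ℤ)
    {f : infGasket → ENNReal} (hf : Measurable f) :
    ∑' i : CellIndex, ∫⁻ x in dyadicTriangle i k, f x ∂σ ≤ 6 * ∫⁻ x, f x ∂σ := by
  have hm : ∀ i : CellIndex, MeasurableSet (dyadicTriangle i k) := fun i =>
    (isClosed_dyadicTriangle i k).measurableSet
  calc ∑' i : CellIndex, ∫⁻ x in dyadicTriangle i k, f x ∂σ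
      = ∑' i : CellIndex, ∫⁻ x, (dyadicTriangle i k).indicator f x ∂σ :=
        tsum_congr fun i => (lintegral_indicator (hm i) f).symm
    _ = ∫⁻ x, ∑' i : CellIndex, (dyadicTriangle i k).indicator f x ∂σ :=
        (lintegral_tsum fun i => (hf.indicator (hm i)).aemeasurable).symm
    _ ≤ ∫⁻ x, 6 * f x ∂σ := by
        refine lintegral_mono fun x => ?_
        refine le_trans (le_of_eq ?_)
          (mul_le_mul_left (tsum_indicator_dyadicTriangle_le k x) (f x))
        rw [← ENNReal.tsum_mul_right]
        refine tsum_congr fun i => ?_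
        by_cases hx : x ∈ dyadicTriangle i k <;> simp [hx]
    _ = 6 * ∫⁻ x, f x ∂σ := lintegral_const_mul _ hf

/-- The embedding of `ℓ^p` into `ℓ^q`; the two hypotheses `p ≤ q` and `2 ≤ q` of the theorem enter
the proof of the inequality through it. -/
lemma tsum_rpow_le_rpow {ι : Type*} {f : ι → ENNReal} {N : ENNReal} {p q : ℝ} (hp : 0 < p)
    (hpq : p ≤ q) (h : ∑' i, f i ^ p ≤ N ^ p) : ∑' i, f i ^ q ≤ N ^ q := by
  have hle : ∀ i, f i ≤ N := fun i =>
    (ENNReal.rpow_le_rpow_iff hp).1 ((ENNReal.le_tsum (f := fun i => f i ^ p) i).trans h)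
  have hsplit : ∀ x : ENNReal, x ^ q = x ^ p * x ^ (q - p) := fun x => by
    rw [← ENNReal.rpow_add_of_nonneg _ _ hp.le (sub_nonneg.2 hpq), add_sub_cancel]
  calc ∑' i, f i ^ q ≤ ∑' i, f i ^ p * N ^ (q - p) := ENNReal.tsum_le_tsum fun i => by
        rw [hsplit]
        exact mul_le_mul_right (ENNReal.rpow_le_rpow (hle i) (sub_nonneg.2 hpq)) _
    _ = (∑' i, f i ^ p) * N ^ (q - p) := ENNReal.tsum_mul_right
    _ ≤ N ^ p * N ^ (q - p) := mul_le_mul_left h _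
    _ = N ^ q := (hsplit N).symm

/-- The infimum of `|u|` on the cell of side `2 ^ k` with label `i`. -/
noncomputable def cellInf (u : infGasket → ℝ) (k : ℤ) (i : CellIndex) : ENNReal :=
  ⨅ ω, ‖u (cellPoint k i ω)‖ₑ

lemma cellInf_le {u : infGasket → ℝ} {k : ℤ} {i : CellIndex} {x : infGasket}
    (hx : x ∈ dyadicTriangle i k) : cellInf u k i ≤ ‖u x‖ₑ := by
  rw [dyadicTriangle_eq_range] at hx
  obtain ⟨ω, rfl⟩ := hx
  exact iInf_le _ ω

lemma enorm_le_cellInf_add {u : infGasket → ℝ} (hu : Continuous u) (k : ℤ) (i : CellIndex)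
    (ω : Addr) :
    ‖u (cellPoint k i ω)‖ₑ ≤ cellInf u k i + 2 * oscBound u k i ^ (1 / 2 : ℝ) := by
  have hosc : ∀ ω, ‖u (cellPoint k i ω) - u (vertex k i 0)‖ₑ ≤ oscBound u k i ^ (1 / 2 : ℝ) := by
    intro ω
    rw [one_div, ENNReal.le_rpow_inv_iff (by norm_num)]
    exact_mod_cast sq_enorm_sub_le_oscBound hu k i ω
  rw [cellInf, ENNReal.iInf_add]
  refine le_iInf fun ω' => ?_
  have h : u (cellPoint k i ω) = u (cellPoint k i ω') +
      ((u (cellPoint k i ω) - u (vertex k i 0)) - (u (cellPoint k i ω') - u (vertex k i 0))) := by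
    ring
  rw [h]
  refine (enorm_add_le _ _).trans (add_le_add le_rfl ?_)
  rw [two_mul]
  exact enorm_sub_le.trans (add_le_add (hosc ω) (hosc ω'))

lemma cellInf_le_of_top {u : infGasket → ℝ} {k : ℤ} {i : CellIndex} {σ : Measure infGasket}
    (hσ : σ (dyadicTriangle i k) ≠ 0) : cellInf u k i ≤ eLpNorm u ⊤ σ := by
  by_contra! h
  refine hσ (measure_mono_null (fun x hx => ?_)
    (ae_iff.1 (enorm_ae_le_eLpNormEssSup u σ)))
  rw [eLpNorm_exponent_top] at h
  exact not_le.2 (h.trans_le (cellInf_le hx))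

lemma tsum_cellInf_rpow_le {u : infGasket → ℝ} (hu : Continuous u) {k : ℤ}
    {σ : Measure infGasket} {K : ENNReal} (hK0 : K ≠ 0) (hK : K ≠ ⊤)
    (hσ : ∀ i, K ≤ σ (dyadicTriangle i k)) {p : ENNReal} (hp : 1 ≤ p) (hptop : p ≠ ⊤) :
    ∑' i, cellInf u k i ^ p.toReal ≤ (6 * (K ^ (-p.toReal⁻¹) * eLpNorm u p σ)) ^ p.toReal := by
  have hp0 : p ≠ 0 := (zero_lt_one.trans_le hp).ne'
  have hpr : 1 ≤ p.toReal := by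
    rw [← ENNReal.toReal_one]; exact ENNReal.toReal_mono hptop hp
  have hmeas : Measurable fun x => ‖u x‖ₑ ^ p.toReal := (hu.measurable.enorm).pow_const _
  have hcell : ∀ i, K * cellInf u k i ^ p.toReal ≤
      ∫⁻ x in dyadicTriangle i k, ‖u x‖ₑ ^ p.toReal ∂σ := by
    intro i
    refine le_trans ?_ (setLIntegral_mono' (isClosed_dyadicTriangle i k).measurableSet
      fun x hx => ENNReal.rpow_le_rpow (cellInf_le hx) (by linarith))
    rw [setLIntegral_const, mul_comm]
    exact mul_le_mul_right (hσ i) _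
  have hsum : K * ∑' i, cellInf u k i ^ p.toReal ≤ 6 * eLpNorm u p σ ^ p.toReal := by
    rw [← ENNReal.tsum_mul_left, eLpNorm_eq_lintegral_rpow_enorm_toReal hp0 hptop,
      ← ENNReal.rpow_mul, one_div_mul_cancel (by linarith), ENNReal.rpow_one]
    exact (ENNReal.tsum_le_tsum hcell).trans (tsum_setLIntegral_dyadicTriangle_le σ k hmeas)
  rw [ENNReal.mul_rpow_of_nonneg _ _ (by linarith), ENNReal.mul_rpow_of_nonneg _ _ (by linarith),
    ← ENNReal.rpow_mul, neg_mul, inv_mul_cancel₀ (by linarith), ENNReal.rpow_neg_one]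
  calc ∑' i, cellInf u k i ^ p.toReal = K⁻¹ * (K * ∑' i, cellInf u k i ^ p.toReal) := by
        rw [← mul_assoc, ENNReal.inv_mul_cancel hK0 hK, one_mul]
    _ ≤ K⁻¹ * (6 * eLpNorm u p σ ^ p.toReal) := mul_le_mul_right hsum _
    _ = 6 * (K⁻¹ * eLpNorm u p σ ^ p.toReal) := mul_left_comm _ _ _
    _ ≤ _ := by
        -- The overlap constant is enlarged from `6` to `6 ^ p`, so that it becomes `6` after the
        -- root, uniformly in `p`.
        refine mul_le_mul_left ?_ _
        conv_lhs => rw [← ENNReal.rpow_one 6]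
        exact ENNReal.rpow_le_rpow_of_exponent_le (by norm_num) hpr

lemma lintegral_infMeasure (k : ℤ) {f : infGasket → ENNReal} (hf : Measurable f) :
    ∫⁻ x, f x ∂infMeasure = (3 : ENNReal) ^ (k : ℝ) * ∑' i, ∫⁻ ω, f (cellPoint k i ω) ∂bernoulli := by
  rw [infMeasure_eq k, lintegral_smul_measure, cellSum, lintegral_sum_measure, smul_eq_mul]
  congr 1
  exact tsum_congr fun i => lintegral_map hf (measurable_cellPoint k i)

/-- Pointwise bounds on cells turn into an `L^q` bound because each cell has mass `3 ^ k`. The crude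
inequality `(a + b) ^ q ≤ 2 ^ q (a ^ q + b ^ q)` keeps the constant independent of `q`; the suprema
`X`, `Y` serve the case `q = ∞`. -/
lemma eLpNorm_le_of_cell_bounds {u : infGasket → ℝ} (hu : Continuous u) (k : ℤ) {q : ENNReal}
    (hq : 1 ≤ q) {f g : CellIndex → ENNReal} {X Y : ENNReal}
    (hfg : ∀ i ω, ‖u (cellPoint k i ω)‖ₑ ≤ f i + g i)
    (hfX : ∀ i, f i ≤ X) (hgY : ∀ i, g i ≤ Y)
    (hf : q ≠ ⊤ → ∑' i, f i ^ q.toReal ≤ X ^ q.toReal)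
    (hg : q ≠ ⊤ → ∑' i, g i ^ q.toReal ≤ Y ^ q.toReal) :
    eLpNorm u q infMeasure ≤ (3 : ENNReal) ^ ((k : ℝ) * q⁻¹.toReal) * (2 * (X + Y)) := by
  rcases eq_or_ne q ⊤ with rfl | hqtop
  · rw [eLpNorm_exponent_top, ENNReal.inv_top, ENNReal.toReal_zero, mul_zero, ENNReal.rpow_zero,
      one_mul]
    refine eLpNormEssSup_le_of_ae_enorm_bound (Eventually.of_forall fun z => ?_)
    obtain ⟨i, ω, rfl⟩ := exists_cellPoint_eq k z
    refine ((hfg i ω).trans (add_le_add (hfX i) (hgY i))).trans ?_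
    rw [two_mul]
    exact le_self_add
  have hq0 : q ≠ 0 := (zero_lt_one.trans_le hq).ne'
  have hqr : 1 ≤ q.toReal := by
    rw [← ENNReal.toReal_one]; exact ENNReal.toReal_mono hqtop hq
  have hq0' : 0 ≤ q.toReal := by linarith
  have hmeas : Measurable fun x => ‖u x‖ₑ ^ q.toReal := (hu.measurable.enorm).pow_const _
  have hpt : ∀ a b : ENNReal, (a + b) ^ q.toReal ≤ 2 ^ q.toReal * (a ^ q.toReal + b ^ q.toReal) := by
    intro a b
    have h1 : a + b ≤ 2 * max a b := by
      rw [two_mul]; exact add_le_add (le_max_left _ _) (le_max_right _ _)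
    refine (ENNReal.rpow_le_rpow h1 hq0').trans ?_
    rw [ENNReal.mul_rpow_of_nonneg _ _ hq0']
    refine mul_le_mul_right ?_ _
    rcases le_total a b with h | h
    · rw [max_eq_right h]; exact le_add_self
    · rw [max_eq_left h]; exact le_self_add
  have hint : ∫⁻ x, ‖u x‖ₑ ^ q.toReal ∂infMeasure ≤
      (3 : ENNReal) ^ (k : ℝ) * (2 * (X + Y)) ^ q.toReal := by
    rw [lintegral_infMeasure k hmeas]
    refine mul_le_mul_right ?_ _
    calc ∑' i, ∫⁻ ω, ‖u (cellPoint k i ω)‖ₑ ^ q.toReal ∂bernoulli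
        ≤ ∑' i, 2 ^ q.toReal * (f i ^ q.toReal + g i ^ q.toReal) := by
          refine ENNReal.tsum_le_tsum fun i => ?_
          refine (lintegral_mono fun ω =>
            (ENNReal.rpow_le_rpow (hfg i ω) hq0').trans (hpt _ _)).trans ?_
          simp
      _ = 2 ^ q.toReal * (∑' i, f i ^ q.toReal + ∑' i, g i ^ q.toReal) := by
          rw [ENNReal.tsum_mul_left, ENNReal.tsum_add]
      _ ≤ 2 ^ q.toReal * (X + Y) ^ q.toReal :=
          mul_le_mul_right ((add_le_add (hf hqtop) (hg hqtop)).trans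
            (ENNReal.add_rpow_le_rpow_add _ _ hqr)) _
      _ = (2 * (X + Y)) ^ q.toReal := (ENNReal.mul_rpow_of_nonneg _ _ hq0').symm
  rw [eLpNorm_eq_lintegral_rpow_enorm_toReal hq0 hqtop]
  refine (ENNReal.rpow_le_rpow hint (by positivity)).trans_eq ?_
  rw [ENNReal.mul_rpow_of_nonneg _ _ (by positivity), ← ENNReal.rpow_mul, ← ENNReal.rpow_mul,
    mul_one_div_cancel (by linarith), ENNReal.rpow_one, ENNReal.toReal_inv, one_div]

/-! ### The inequality at a fixed scale. -/

lemma three_rpow_deltaS : (3 : ℝ) ^ (1 / deltaS) = 5 / 3 := by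
  have h3 : Real.log 3 ≠ 0 := (Real.log_pos (by norm_num)).ne'
  rw [deltaS, one_div_one_div, Real.rpow_def_of_pos (by norm_num), mul_sub, mul_div_cancel₀ _ h3,
    mul_one, Real.exp_sub, Real.exp_log (by norm_num), Real.exp_log (by norm_num)]

/-- The upper bound, together with `1/q ≤ 1/2`, gives growth rate at most one for the energy term,
so that rounding the scale to an integer costs at most a factor `3`. -/
lemma one_div_two_deltaS : 0 < 1 / (2 * deltaS) ∧ 1 / (2 * deltaS) ≤ 1 / 2 := by
  have h : 1 / (2 * deltaS) = (1 / deltaS) / 2 := by rw [div_div, mul_comm]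
  have h1 : 0 < 1 / deltaS := by
    by_contra! hn
    have := Real.rpow_le_one_of_one_le_of_nonpos (by norm_num : (1 : ℝ) ≤ 3) hn
    rw [three_rpow_deltaS] at this
    norm_num at this
  have h2 : 1 / deltaS ≤ 1 := by
    by_contra! hn
    have := Real.rpow_lt_rpow_of_exponent_lt (by norm_num : (1 : ℝ) < 3) hn
    rw [three_rpow_deltaS] at this
    norm_num at this
  rw [h]
  constructor <;> linarith

lemma eLpNorm_le_at_scale {p q : ENNReal} (hp : 1 ≤ p) (hpq : p ≤ q) (h2q : 2 ≤ q) {C δ : ℝ}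
    (hC : 1 ≤ C) {σ : Measure infGasket} {k : ℤ}
    (hσ : ∀ i, ENNReal.ofReal C⁻¹ * infMeasure (dyadicTriangle i k) ^ (1 / δ) ≤
      σ (dyadicTriangle i k)) {u : infGasket → ℝ} (hu : Continuous u) :
    eLpNorm u q infMeasure ≤ ENNReal.ofReal (216 * C) *
      (ENNReal.ofReal (3 ^ ((k : ℝ) * (q⁻¹.toReal + 1 / (2 * deltaS)))) *
          energy u ^ (1 / 2 : ℝ) +
        ENNReal.ofReal (3 ^ (-(k : ℝ) * (p⁻¹.toReal / δ - q⁻¹.toReal))) * eLpNorm u p σ) := by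
  have hC0 : 0 < C := by linarith
  set P := p⁻¹.toReal with hP
  set Q := q⁻¹.toReal with hQ
  have hP' : P = p.toReal⁻¹ := ENNReal.toReal_inv p
  have hP0 : 0 ≤ P := ENNReal.toReal_nonneg
  have hP1 : P ≤ 1 := by
    have := ENNReal.toReal_mono ENNReal.one_ne_top (ENNReal.inv_le_one.2 hp)
    rwa [ENNReal.toReal_one] at this
  set κ : ℝ := C⁻¹ * 3 ^ ((k : ℝ) / δ) with hκ
  have hκ0 : 0 < κ := by positivity
  have h3 : ∀ x : ℝ, (3 : ENNReal) ^ x = ENNReal.ofReal (3 ^ x) := fun x => by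
    rw [← ENNReal.ofReal_rpow_of_pos (by norm_num)]; simp
  have hσ' : ∀ i, ENNReal.ofReal κ ≤ σ (dyadicTriangle i k) := by
    intro i
    refine le_trans (le_of_eq ?_) (hσ i)
    rw [infMeasure_dyadicTriangle, ← ENNReal.rpow_mul, h3, ← ENNReal.ofReal_mul (by positivity), hκ,
      mul_one_div]
  have hκne : ENNReal.ofReal κ ≠ 0 := by simpa using hκ0
  set X : ENNReal := 6 * (ENNReal.ofReal κ ^ (-P) * eLpNorm u p σ) with hX
  set Y : ENNReal := 2 * (∑' i, oscBound u k i) ^ (1 / 2 : ℝ) with hY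
  have hg2 : ∑' i, (2 * oscBound u k i ^ (1 / 2 : ℝ)) ^ (2 : ℝ) ≤ Y ^ (2 : ℝ) := by
    have hsq : ∀ x : ENNReal, (2 * x ^ (1 / 2 : ℝ)) ^ (2 : ℝ) = 2 ^ (2 : ℝ) * x := fun x => by
      rw [ENNReal.mul_rpow_of_nonneg _ _ (by norm_num), ← ENNReal.rpow_mul,
        one_div_mul_cancel (by norm_num), ENNReal.rpow_one]
    rw [hY, hsq]
    simp only [hsq]
    rw [ENNReal.tsum_mul_left]
  have hgY : ∀ i, 2 * oscBound u k i ^ (1 / 2 : ℝ) ≤ Y := fun i =>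
    mul_le_mul_right (ENNReal.rpow_le_rpow (ENNReal.le_tsum i) (by norm_num)) _
  have hfp : p ≠ ⊤ → ∑' i, cellInf u k i ^ p.toReal ≤ X ^ p.toReal := fun hptop => by
    rw [hX, hP']
    exact tsum_cellInf_rpow_le hu hκne ENNReal.ofReal_ne_top hσ' hp hptop
  have hprpos : p ≠ ⊤ → 0 < p.toReal := fun h =>
    ENNReal.toReal_pos (zero_lt_one.trans_le hp).ne' h
  have hfX : ∀ i, cellInf u k i ≤ X := by
    intro i
    rcases eq_or_ne p ⊤ with rfl | hptop
    · have h0 : P = 0 := by rw [hP, ENNReal.inv_top, ENNReal.toReal_zero]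
      have hσ0 : σ (dyadicTriangle i k) ≠ 0 :=
        ((pos_iff_ne_zero.2 hκne).trans_le (hσ' i)).ne'
      rw [hX, h0, neg_zero, ENNReal.rpow_zero, one_mul]
      refine (cellInf_le_of_top hσ0).trans ?_
      conv_lhs => rw [← one_mul (eLpNorm u ⊤ σ)]
      exact mul_le_mul_left (by norm_num) _
    · exact (ENNReal.rpow_le_rpow_iff (hprpos hptop)).1
        ((ENNReal.le_tsum (f := fun i => cellInf u k i ^ p.toReal) i).trans (hfp hptop))
  have main := eLpNorm_le_of_cell_bounds hu k (le_trans (by norm_num) h2q)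
    (enorm_le_cellInf_add hu k) hfX hgY
    (fun hq => have hptop := ne_top_of_le_ne_top hq hpq
      tsum_rpow_le_rpow (hprpos hptop) (ENNReal.toReal_mono hq hpq) (hfp hptop))
    (fun hq => tsum_rpow_le_rpow (by norm_num)
      (by simpa using ENNReal.toReal_mono hq h2q) hg2)
  have hXle : X ≤ ENNReal.ofReal (6 * C * 3 ^ (-(k : ℝ) * (P / δ))) * eLpNorm u p σ := by
    rw [hX, ← mul_assoc, ENNReal.ofReal_rpow_of_pos hκ0,
      show (6 : ENNReal) = ENNReal.ofReal 6 by simp, ← ENNReal.ofReal_mul (by norm_num)]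
    refine mul_le_mul_left (ENNReal.ofReal_le_ofReal ?_) _
    rw [mul_assoc]
    refine mul_le_mul_of_nonneg_left ?_ (by norm_num)
    rw [hκ, Real.mul_rpow (by positivity) (by positivity), ← Real.rpow_mul (by norm_num),
      Real.inv_rpow hC0.le, Real.rpow_neg hC0.le, inv_inv]
    -- Here `C ≥ 1` and `1/p ≤ 1` remove the dependence of the constant on `p`.
    have h1 : C ^ P ≤ C := by
      conv_rhs => rw [← Real.rpow_one C]
      exact Real.rpow_le_rpow_of_exponent_le hC hP1
    refine (mul_le_mul_of_nonneg_right h1 (by positivity)).trans_eq ?_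
    congr 2; ring
  have hYle : Y ≤ ENNReal.ofReal (108 * 3 ^ ((k : ℝ) * (1 / (2 * deltaS)))) *
      energy u ^ (1 / 2 : ℝ) := by
    have h1 := ENNReal.rpow_le_rpow (tsum_oscBound_le u k) (by norm_num : (0 : ℝ) ≤ 1 / 2)
    rw [ENNReal.mul_rpow_of_nonneg _ _ (by norm_num), ENNReal.ofReal_rpow_of_pos (by positivity),
      Real.mul_rpow (by norm_num) (by positivity)] at h1
    have h2 : ((5 / 3 : ℝ) ^ k) ^ (1 / 2 : ℝ) = 3 ^ ((k : ℝ) * (1 / (2 * deltaS))) := by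
      rw [← three_rpow_deltaS, ← Real.rpow_mul_intCast (by norm_num), ← Real.rpow_mul (by norm_num)]
      congr 1
      rw [mul_comm (2 : ℝ) deltaS, ← div_div]; ring
    have h4 : (2880 : ℝ) ^ (1 / 2 : ℝ) ≤ 54 := by
      rw [← Real.sqrt_eq_rpow]
      exact Real.sqrt_le_iff.2 ⟨by norm_num, by norm_num⟩
    rw [h2] at h1
    rw [hY]
    refine (mul_le_mul_right h1 2).trans ?_
    rw [← mul_assoc, show (2 : ENNReal) = ENNReal.ofReal 2 by simp,
      ← ENNReal.ofReal_mul (by norm_num), ← mul_assoc]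
    refine mul_le_mul_left (ENNReal.ofReal_le_ofReal ?_) _
    refine mul_le_mul_of_nonneg_right ?_ (by positivity)
    linarith
  refine main.trans ((mul_le_mul_right (mul_le_mul_right (add_le_add hXle hYle) _) _).trans ?_)
  have htwo : ∀ x : ENNReal, ENNReal.ofReal (3 ^ ((k : ℝ) * Q)) * (2 * x) =
      ENNReal.ofReal (3 ^ ((k : ℝ) * Q) * 2) * x := fun x => by
    rw [ENNReal.ofReal_mul (by positivity), ENNReal.ofReal_ofNat, mul_assoc]
  rw [h3, htwo, mul_add, mul_add, add_comm, ← mul_assoc, ← mul_assoc, ← mul_assoc, ← mul_assoc, ← ENNReal.ofReal_mul (by positivity),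
    ← ENNReal.ofReal_mul (by positivity), ← ENNReal.ofReal_mul (by positivity),
    ← ENNReal.ofReal_mul (by positivity)]
  have e1 : (3 : ℝ) ^ ((k : ℝ) * (Q + 1 / (2 * deltaS))) =
      3 ^ ((k : ℝ) * Q) * 3 ^ ((k : ℝ) * (1 / (2 * deltaS))) := by
    rw [mul_add, Real.rpow_add (by norm_num)]
  have e2 : (3 : ℝ) ^ (-(k : ℝ) * (P / δ - Q)) = 3 ^ ((k : ℝ) * Q) * 3 ^ (-(k : ℝ) * (P / δ)) := by
    rw [← Real.rpow_add (by norm_num)]; congr 1; ring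
  refine add_le_add (mul_le_mul_left (ENNReal.ofReal_le_ofReal ?_) _)
    (mul_le_mul_left (ENNReal.ofReal_le_ofReal ?_) _)
  · rw [e1]
    have h0 : 0 < (3 : ℝ) ^ ((k : ℝ) * Q) * 3 ^ ((k : ℝ) * (1 / (2 * deltaS))) := by positivity
    nlinarith
  · rw [e2]
    have h0 : 0 < C * ((3 : ℝ) ^ ((k : ℝ) * Q) * 3 ^ (-(k : ℝ) * (P / δ))) := by positivity
    nlinarith

/-! ### The inequality -/

/-- Zero energy makes `u` constant on every cell, and each point lies in cells of arbitrarily large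
mass; square-integrability then forces the constant to vanish. -/
lemma eq_zero_of_energy_eq_zero {u : infGasket → ℝ} (hu : u ∈ formDomain) (hE : energy u = 0) :
    u = 0 := by
  obtain ⟨hcont, -, hL2⟩ := hu
  have hosc : ∀ k i ω, u (cellPoint k i ω) = u (vertex k i 0) := by
    intro k i ω
    have h0 := tsum_oscBound_le u k
    rw [hE, mul_zero, nonpos_iff_eq_zero, ENNReal.tsum_eq_zero] at h0
    have h1 := sq_enorm_sub_le_oscBound hcont k i ω
    rw [h0 i, nonpos_iff_eq_zero] at h1
    exact sub_eq_zero.1 (enorm_eq_zero.1 (pow_eq_zero_iff (by norm_num) |>.1 h1))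
  funext z
  by_contra hz
  have hmeas : Measurable fun x => ‖u x‖ₑ ^ (2 : ℝ) := (hcont.measurable.enorm).pow_const _
  have hfin : ∫⁻ x, ‖u x‖ₑ ^ (2 : ℝ) ∂infMeasure < ⊤ := by
    have := lintegral_rpow_enorm_lt_top_of_eLpNorm_lt_top (by norm_num) (by norm_num) hL2.2
    simpa using this
  have hlow : ∀ n : ℕ, (n : ENNReal) * ‖u z‖ₑ ^ (2 : ℝ) ≤ ∫⁻ x, ‖u x‖ₑ ^ (2 : ℝ) ∂infMeasure := by
    intro n
    obtain ⟨i, ω, rfl⟩ := exists_cellPoint_eq n z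
    rw [lintegral_infMeasure n hmeas]
    refine mul_le_mul' ?_ (le_trans (le_of_eq ?_) (ENNReal.le_tsum i))
    · rw [Int.cast_natCast, ENNReal.rpow_natCast]
      exact_mod_cast (Nat.lt_pow_self (by norm_num : 1 < 3)).le
    · simp [hosc]
  have hne : ‖u z‖ₑ ^ (2 : ℝ) ≠ 0 := by
    rw [Ne, ENNReal.rpow_eq_zero_iff_of_pos (by norm_num), enorm_eq_zero]
    exact hz
  obtain ⟨n, hn⟩ := ENNReal.exists_nat_mul_gt hne hfin.ne
  exact absurd (hlow n) (not_le.2 hn)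

/-- The choice of the scale: `A` and `B` are the growth rates of the two terms. -/
lemma exists_scale {e n A B : ℝ} (he : 0 < e) (hn : 0 < n) (hA : 0 < A) (hA1 : A ≤ 1)
    (hAB : 0 < A + B) :
    ∃ k : ℤ, (e ≤ n → 0 ≤ k) ∧ (n < e → k ≤ 0) ∧
      3 ^ ((k : ℝ) * A) * e + 3 ^ (-(k : ℝ) * B) * n ≤
        4 * (e ^ max (B / (A + B)) 0 * n ^ (1 - max (B / (A + B)) 0)) := by
  have h3 : (1 : ℝ) < 3 := by norm_num
  have hr : 0 < n / e := by positivity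
  set l := Real.logb 3 (n / e) with hl
  have h3l : ∀ t : ℝ, (3 : ℝ) ^ (l * t) = n ^ t / e ^ t := fun t => by
    rw [Real.rpow_mul (by norm_num), hl, Real.rpow_logb (by norm_num) (by norm_num) hr,
      Real.div_rpow hn.le he.le]
  have hlpos : e ≤ n → 0 ≤ l := fun h => Real.logb_nonneg h3 ((one_le_div he).2 h)
  have hlneg : n < e → l ≤ 0 := fun h =>
    Real.logb_nonpos h3 hr.le ((div_le_one he).2 h.le)
  rcases le_or_gt B 0 with hB | hB
  -- Here the exponent is zero and no balancing takes place. For `e ≤ n` the scale `k = 0` suffices.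
  -- Otherwise `k ≤ 0` is taken so small that the first term is at most `n`, and going down does not
  -- increase the second.
  · rw [max_eq_right (div_nonpos_of_nonpos_of_nonneg hB hAB.le), Real.rpow_zero, sub_zero,
      Real.rpow_one, one_mul]
    rcases le_or_gt e n with hen | hen
    · refine ⟨0, fun _ => le_rfl, fun _ => le_rfl, ?_⟩
      simp only [Int.cast_zero, zero_mul, neg_zero, Real.rpow_zero, one_mul]
      linarith
    · have hk : ⌊l / A⌋ ≤ 0 := by
        have h1 : l / A ≤ 0 := div_nonpos_of_nonpos_of_nonneg (hlneg hen) hA.le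
        exact_mod_cast (Int.floor_le _).trans h1
      refine ⟨⌊l / A⌋, fun h => absurd h (not_le.2 hen), fun _ => hk, ?_⟩
      have hk' : ((⌊l / A⌋ : ℤ) : ℝ) ≤ 0 := by exact_mod_cast hk
      have h1 : (3 : ℝ) ^ (((⌊l / A⌋ : ℤ) : ℝ) * A) * e ≤ n := by
        have hle : ((⌊l / A⌋ : ℤ) : ℝ) * A ≤ l * 1 := by
          rw [mul_one]
          exact (le_div_iff₀ hA).1 (Int.floor_le _)
        have := Real.rpow_le_rpow_of_exponent_le h3.le hle
        rw [h3l, Real.rpow_one, Real.rpow_one] at this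
        exact (le_div_iff₀ he).1 this
      have h2 : (3 : ℝ) ^ (-((⌊l / A⌋ : ℤ) : ℝ) * B) ≤ 1 :=
        Real.rpow_le_one_of_one_le_of_nonpos h3.le
          (mul_nonpos_of_nonneg_of_nonpos (by linarith) hB)
      nlinarith
  -- The two terms are equal at the real scale `l / (A + B)`. Rounding up costs at most `3 ^ A ≤ 3`
  -- in the first term and only helps the second, which gives `3 + 1 = 4`.
  · set a := B / (A + B) with ha
    have ha0 : 0 ≤ a := by positivity
    have h1a : 1 - a = A / (A + B) := by rw [ha]; field_simp; ring
    rw [max_eq_left ha0]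
    have hprod : 0 < e ^ a * n ^ (1 - a) := by positivity
    refine ⟨⌈l / (A + B)⌉, fun h => Int.ceil_nonneg (div_nonneg (hlpos h) hAB.le), fun h =>
      Int.ceil_le.2 (by simpa using div_nonpos_of_nonpos_of_nonneg (hlneg h) hAB.le), ?_⟩
    set k := ⌈l / (A + B)⌉
    have hk1 : (k : ℝ) * A ≤ 1 + l * (1 - a) := by
      have h2 : (k : ℝ) ≤ l / (A + B) + 1 := (Int.ceil_lt_add_one _).le
      have h4 : l * (1 - a) = l / (A + B) * A := by rw [h1a]; ring
      rw [h4]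
      nlinarith
    have hk2 : -(k : ℝ) * B ≤ l * (-a) := by
      have h2 : l / (A + B) ≤ k := Int.le_ceil _
      have h4 : l * (-a) = -(l / (A + B)) * B := by rw [ha]; ring
      rw [h4]
      nlinarith
    have b1 : (3 : ℝ) ^ ((k : ℝ) * A) * e ≤ 3 * (e ^ a * n ^ (1 - a)) := by
      have := Real.rpow_le_rpow_of_exponent_le h3.le hk1
      rw [Real.rpow_add (by norm_num), Real.rpow_one, h3l] at this
      refine (mul_le_mul_of_nonneg_right this he.le).trans_eq ?_
      have hee : e = e ^ a * e ^ (1 - a) := by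
        rw [← Real.rpow_add he, add_sub_cancel, Real.rpow_one]
      have hne : e ^ (1 - a) ≠ 0 := by positivity
      nth_rewrite 2 [hee]
      field_simp
    have b2 : (3 : ℝ) ^ (-(k : ℝ) * B) * n ≤ e ^ a * n ^ (1 - a) := by
      have := Real.rpow_le_rpow_of_exponent_le h3.le hk2
      rw [h3l] at this
      refine (mul_le_mul_of_nonneg_right this hn.le).trans_eq ?_
      rw [Real.rpow_neg hn.le, Real.rpow_neg he.le, Real.rpow_sub hn, Real.rpow_one]
      field_simp
    linarith

lemma exponent_eq (p q : ENNReal) (δ : ℝ) :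
    exponent p q δ = max ((p⁻¹.toReal / δ - q⁻¹.toReal) /
      ((q⁻¹.toReal + 1 / (2 * deltaS)) + (p⁻¹.toReal / δ - q⁻¹.toReal))) 0 := by
  rw [exponent]
  congr 2
  ring

lemma growth_sum_pos (p q : ENNReal) {δ : ℝ} (hδ : 0 < δ) :
    0 < (q⁻¹.toReal + 1 / (2 * deltaS)) + (p⁻¹.toReal / δ - q⁻¹.toReal) := by
  have h1 := one_div_two_deltaS.1
  have h2 : 0 ≤ p⁻¹.toReal / δ := by positivity
  linarith

lemma exponent_nonneg (p q : ENNReal) (δ : ℝ) : 0 ≤ exponent p q δ := le_max_right _ _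

lemma exponent_lt_one (p q : ENNReal) {δ : ℝ} (hδ : 0 < δ) : exponent p q δ < 1 := by
  rw [exponent_eq]
  refine max_lt ((div_lt_one (growth_sum_pos p q hδ)).2 ?_) one_pos
  have h1 := one_div_two_deltaS.1
  have h2 : 0 ≤ q⁻¹.toReal := ENNReal.toReal_nonneg
  linarith

lemma lowerDyadic_cell {σ : Measure infGasket} {C δl δu : ℝ} (h : LowerDyadic σ C δl δu)
    (k : ℤ) (i : CellIndex) :
    ENNReal.ofReal C⁻¹ * infMeasure (dyadicTriangle i k) ^ (1 / (if k < 0 then δl else δu)) ≤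
      σ (dyadicTriangle i k) := by
  have h2 := h _ ⟨i, k, rfl⟩
  rw [diam_dyadicTriangle] at h2
  split_ifs with hk
  · exact h2.1 ⟨by positivity, zpow_lt_one_of_neg₀ (by norm_num) hk⟩
  · exact h2.2 (one_le_zpow₀ (by norm_num) (not_lt.1 hk))

lemma eLpNorm_le_energy_mul_eLpNorm {p q : ENNReal} (hp : 1 ≤ p) (hpq : p ≤ q) (h2q : 2 ≤ q)
    {C δl δu : ℝ} (hC : 1 ≤ C) (hδl : 0 < δl) (hδu : 0 < δu) {σ : Measure infGasket}
    (hσ : LowerDyadic σ C δl δu) {u : infGasket → ℝ} (hu : u ∈ formDomain) :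
    eLpNorm u q infMeasure ≤ ENNReal.ofReal (864 * C) *
      (energy u ^ (exponent p q δl / 2) * eLpNorm u p σ ^ (1 - exponent p q δl) +
       energy u ^ (exponent p q δu / 2) * eLpNorm u p σ ^ (1 - exponent p q δu)) := by
  have hC0 : 0 < C := by linarith
  rcases eq_or_ne (energy u) 0 with hE | hE
  · rw [eq_zero_of_energy_eq_zero hu hE]
    simp
  have hEtop : energy u ≠ ⊤ := hu.2.1.ne
  have scale : ∀ k : ℤ, eLpNorm u q infMeasure ≤ ENNReal.ofReal (216 * C) *
      (ENNReal.ofReal (3 ^ ((k : ℝ) * (q⁻¹.toReal + 1 / (2 * deltaS)))) *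
          energy u ^ (1 / 2 : ℝ) +
        ENNReal.ofReal (3 ^ (-(k : ℝ) * (p⁻¹.toReal / (if k < 0 then δl else δu) - q⁻¹.toReal))) *
          eLpNorm u p σ) := fun k =>
    eLpNorm_le_at_scale hp hpq h2q hC (lowerDyadic_cell hσ k) hu.1
  have hA : 0 < q⁻¹.toReal + 1 / (2 * deltaS) :=
    add_pos_of_nonneg_of_pos ENNReal.toReal_nonneg one_div_two_deltaS.1
  have hA1 : q⁻¹.toReal + 1 / (2 * deltaS) ≤ 1 := by
    have h1 := ENNReal.toReal_mono (by norm_num) (ENNReal.inv_le_inv.2 h2q)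
    have h2 := one_div_two_deltaS.2
    rw [ENNReal.toReal_inv, ENNReal.toReal_inv, ENNReal.toReal_ofNat] at h1
    rw [ENNReal.toReal_inv]
    linarith
  set e : ℝ := (energy u ^ (1 / 2 : ℝ)).toReal with he
  have hehalf : energy u ^ (1 / 2 : ℝ) = ENNReal.ofReal e :=
    (ENNReal.ofReal_toReal (ENNReal.rpow_ne_top_of_nonneg (by norm_num) hEtop)).symm
  have he0 : 0 < e := ENNReal.toReal_pos
    (ENNReal.rpow_pos (pos_iff_ne_zero.2 hE) hEtop).ne'
    (ENNReal.rpow_ne_top_of_nonneg (by norm_num) hEtop)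
  have hepow : ∀ a : ℝ, 0 ≤ a → energy u ^ (a / 2) = ENNReal.ofReal (e ^ a) := fun a ha => by
    rw [← ENNReal.ofReal_rpow_of_nonneg he0.le ha, ← hehalf, ← ENNReal.rpow_mul]
    congr 1; ring
  -- An infinite norm makes the right-hand side infinite because the exponent `1 - a` is strictly
  -- positive and the energy is nonzero.
  rcases eq_or_ne (eLpNorm u p σ) ⊤ with hn | hntop
  · rw [hn, ENNReal.top_rpow_of_pos (sub_pos.2 (exponent_lt_one p q hδl)), ENNReal.mul_top,
      top_add, ENNReal.mul_top]
    · exact le_top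
    · rw [Ne, ENNReal.ofReal_eq_zero, not_le]; positivity
    · rw [hepow _ (exponent_nonneg _ _ _), Ne, ENNReal.ofReal_eq_zero, not_le]; positivity
  rcases eq_or_ne (eLpNorm u p σ) 0 with hn | hn0
  -- With the norm term absent, the scale estimate may be sent to `k → -∞`, where the energy term
  -- vanishes.
  · suffices h : eLpNorm u q infMeasure = 0 by rw [h]; exact zero_le
    simp only [hn, mul_zero, add_zero, hehalf] at scale
    refine le_antisymm (ge_of_tendsto' (x := atBot) (f := fun k : ℤ => ENNReal.ofReal (216 * C) *
      (ENNReal.ofReal (3 ^ ((k : ℝ) * (q⁻¹.toReal + 1 / (2 * deltaS)))) * ENNReal.ofReal e))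
      ?_ scale) zero_le
    have h1 : Tendsto (fun k : ℤ => (3 : ℝ) ^ ((k : ℝ) * (q⁻¹.toReal + 1 / (2 * deltaS)))) atBot
        (𝓝 0) :=
      (tendsto_rpow_atBot_of_base_gt_one 3 (by norm_num)).comp
        ((tendsto_intCast_atBot_iff.2 tendsto_id).atBot_mul_const hA)
    have h2 := ENNReal.Tendsto.const_mul (a := ENNReal.ofReal (216 * C))
      (ENNReal.Tendsto.mul_const (b := ENNReal.ofReal e) (ENNReal.tendsto_ofReal h1)
        (Or.inr ENNReal.ofReal_ne_top)) (Or.inr ENNReal.ofReal_ne_top)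
    simpa using h2
  set n : ℝ := (eLpNorm u p σ).toReal with hndef
  have hnof : eLpNorm u p σ = ENNReal.ofReal n := (ENNReal.ofReal_toReal hntop).symm
  have hn0' : 0 < n := ENNReal.toReal_pos hn0 hntop
  have final : ∀ δ : ℝ, ∀ k : ℤ,
      3 ^ ((k : ℝ) * (q⁻¹.toReal + 1 / (2 * deltaS))) * e +
        3 ^ (-(k : ℝ) * (p⁻¹.toReal / (if k < 0 then δl else δu) - q⁻¹.toReal)) * n ≤
          4 * (e ^ exponent p q δ * n ^ (1 - exponent p q δ)) →
      eLpNorm u q infMeasure ≤ ENNReal.ofReal (864 * C) *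
        (energy u ^ (exponent p q δ / 2) * eLpNorm u p σ ^ (1 - exponent p q δ)) := by
    intro δ k hk
    refine (scale k).trans ?_
    rw [hehalf, hepow _ (exponent_nonneg _ _ _), hnof, ENNReal.ofReal_rpow_of_pos hn0',
      ← ENNReal.ofReal_mul (by positivity), ← ENNReal.ofReal_mul (by positivity),
      ← ENNReal.ofReal_mul (by positivity), ← ENNReal.ofReal_add (by positivity) (by positivity),
      ← ENNReal.ofReal_mul (by positivity), ← ENNReal.ofReal_mul (by positivity)]
    refine ENNReal.ofReal_le_ofReal ?_
    have := mul_le_mul_of_nonneg_left hk (by positivity : 0 ≤ 216 * C)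
    linarith
  rcases le_or_gt e n with hen | hen
  · obtain ⟨k, hk, -, hbound⟩ := exists_scale he0 hn0' hA hA1 (growth_sum_pos p q hδu)
    rw [← exponent_eq] at hbound
    have h := final δu k (by rwa [if_neg (not_lt.2 (hk hen))])
    exact h.trans (mul_le_mul_right le_add_self _)
  · obtain ⟨k, -, hk, hbound⟩ := exists_scale he0 hn0' hA hA1 (growth_sum_pos p q hδl)
    rw [← exponent_eq] at hbound
    -- The estimate with exponent `δl` is available for `k < 0` only; at `k = 0` the power of three
    -- is one, so the choice of exponent is immaterial.
    have h := final δl k (by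
      rcases (hk hen).lt_or_eq with h | rfl
      · rwa [if_pos h]
      · simpa using hbound)
    exact h.trans (mul_le_mul_right le_self_add _)

/-! ### Harmonic functions -/

/-- The values at the corners of the subcell `a` of the harmonic function with corner values `x`. -/
noncomputable def harmStep (a : Fin 3) (x : Fin 3 → ℝ) : Fin 3 → ℝ := fun b =>
  if b = a then x a else (x a + x b + ∑ c, x c) / 5

/-- The values at the corners of the subcell of generation `n` that contains the point with
address `ω`. -/
noncomputable def harmVec : ℕ → (Fin 3 → ℝ) → Addr → Fin 3 → ℝ
  | 0, x, _ => x
  | n + 1, x, ω => harmVec n (harmStep (ω 0) x) ω.tail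

/-- The value at the point with address `ω` of the harmonic function with corner values `x`. -/
noncomputable def harm (x : Fin 3 → ℝ) (ω : Addr) : ℝ :=
  limUnder atTop fun n => harmVec n x ω 0

lemma harmStep_self (a : Fin 3) (x : Fin 3 → ℝ) : harmStep a x a = x a := if_pos rfl

/-- The subcells `a` and `b` share the midpoint of their side; this symmetry is the compatibility
that makes `harm` a function of the point. -/
lemma harmStep_comm (a b : Fin 3) (x : Fin 3 → ℝ) : harmStep a x b = harmStep b x a := by
  unfold harmStep
  by_cases h : b = a
  · rw [h]
  · rw [if_neg h, if_neg (Ne.symm h), add_comm (x a)]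

lemma harmStep_mem_Icc {l r : ℝ} {x : Fin 3 → ℝ} (hx : ∀ b, x b ∈ Set.Icc l r) (a b : Fin 3) :
    harmStep a x b ∈ Set.Icc l r := by
  unfold harmStep
  split_ifs with h
  · exact hx a
  · have h0 := hx 0
    have h1 := hx 1
    have h2 := hx 2
    have ha := hx a
    have hb := hx b
    rw [Fin.sum_univ_three]
    simp only [Set.mem_Icc] at *
    constructor <;> linarith

/-- The contraction by `3/5` yields convergence of the corner values along an address, as well as
continuity of the limit. -/
lemma abs_harmStep_sub_le {d : ℝ} {x : Fin 3 → ℝ} (hx : ∀ b c, |x b - x c| ≤ d) (a b c : Fin 3) :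
    |harmStep a x b - harmStep a x c| ≤ d * (3 / 5) := by
  have hd0 : 0 ≤ d := (abs_nonneg _).trans (hx 0 0)
  have h01 := abs_le.1 (hx 0 1)
  have h02 := abs_le.1 (hx 0 2)
  have h12 := abs_le.1 (hx 1 2)
  rw [abs_le]
  unfold harmStep
  rw [Fin.sum_univ_three]
  fin_cases a <;> fin_cases b <;> fin_cases c <;> simp <;>
    first
    | exact hd0
    | constructor <;> linarith

lemma harmVec_mem_Icc {l r : ℝ} {x : Fin 3 → ℝ} (hx : ∀ b, x b ∈ Set.Icc l r) (n : ℕ) (ω : Addr)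
    (b : Fin 3) : harmVec n x ω b ∈ Set.Icc l r := by
  induction n generalizing x ω with
  | zero => exact hx b
  | succ n ih => exact ih (harmStep_mem_Icc hx (ω 0)) _

lemma abs_harmVec_succ_sub_le {d : ℝ} {x : Fin 3 → ℝ} (hx : ∀ b c, |x b - x c| ≤ d) (n : ℕ)
    (ω : Addr) (b : Fin 3) : |harmVec n x ω b - harmVec (n + 1) x ω b| ≤ d * (3 / 5) ^ n := by
  induction n generalizing x d ω with
  | zero =>
    have hd : ∀ c, x c ∈ Set.Icc (x b - d) (x b + d) := fun c => by
      have := abs_le.1 (hx b c)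
      constructor <;> linarith
    have := harmStep_mem_Icc hd (ω 0) b
    simp only [harmVec, pow_zero, mul_one, abs_le]
    constructor <;> linarith [this.1, this.2]
  | succ n ih =>
    refine (ih (abs_harmStep_sub_le hx (ω 0)) _).trans_eq ?_
    rw [pow_succ']; ring

lemma exists_osc_bound (x : Fin 3 → ℝ) : ∃ d, ∀ b c, |x b - x c| ≤ d :=
  ⟨∑ b, ∑ c, |x b - x c|, fun b c =>
    (Finset.single_le_sum (f := fun c => |x b - x c|) (fun _ _ => abs_nonneg _)
      (Finset.mem_univ c)).trans
    (Finset.single_le_sum (f := fun b => ∑ c, |x b - x c|)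
      (fun _ _ => Finset.sum_nonneg fun _ _ => abs_nonneg _) (Finset.mem_univ b))⟩

lemma tendsto_harmVec (x : Fin 3 → ℝ) (ω : Addr) :
    Tendsto (fun n => harmVec n x ω 0) atTop (𝓝 (harm x ω)) := by
  obtain ⟨d, hd⟩ := exists_osc_bound x
  exact (cauchySeq_of_le_geometric (3 / 5) d (by norm_num) fun n => by
    rw [Real.dist_eq]; exact abs_harmVec_succ_sub_le hd n ω 0).tendsto_limUnder

lemma harm_cons (x : Fin 3 → ℝ) (a : Fin 3) (ω : Addr) :
    harm x (Addr.cons a ω) = harm (harmStep a x) ω :=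
  tendsto_nhds_unique ((tendsto_add_atTop_iff_nat 1).2 (tendsto_harmVec x (Addr.cons a ω)))
    (tendsto_harmVec (harmStep a x) ω)

lemma harm_mem_Icc {l r : ℝ} {x : Fin 3 → ℝ} (hx : ∀ b, x b ∈ Set.Icc l r) (ω : Addr) :
    harm x ω ∈ Set.Icc l r :=
  isClosed_Icc.mem_of_tendsto (tendsto_harmVec x ω)
    (Eventually.of_forall fun n => harmVec_mem_Icc hx n ω 0)

lemma harm_sub_mem {d : ℝ} {x : Fin 3 → ℝ} (hx : ∀ b c, |x b - x c| ≤ d) (ω : Addr) (a : Fin 3) :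
    |harm x ω - x a| ≤ d := by
  have := harm_mem_Icc (l := x a - d) (r := x a + d) (fun b => by
    have := abs_le.1 (hx a b)
    constructor <;> linarith) ω
  rw [abs_le]
  constructor <;> linarith [this.1, this.2]

lemma harm_const (x : Fin 3 → ℝ) (a : Fin 3) : harm x (Addr.const a) = x a := by
  obtain ⟨d, hd⟩ := exists_osc_bound x
  have key : ∀ n : ℕ, ∀ (x : Fin 3 → ℝ) (d : ℝ), (∀ b c, |x b - x c| ≤ d) →
      |harm x (Addr.const a) - x a| ≤ d * (3 / 5) ^ n := by
    intro n
    induction n with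
    | zero =>
      intro x d hx
      simpa using harm_sub_mem hx (Addr.const a) a
    | succ n ih =>
      intro x d hx
      have := ih (harmStep a x) _ (abs_harmStep_sub_le hx a)
      rw [← harm_cons, Addr.cons_const, harmStep_self] at this
      refine this.trans_eq ?_
      rw [pow_succ']; ring
  have hlim : Tendsto (fun n : ℕ => d * (3 / 5 : ℝ) ^ n) atTop (𝓝 (d * 0)) :=
    (tendsto_pow_atTop_nhds_zero_of_lt_one (by norm_num) (by norm_num)).const_mul d
  rw [mul_zero] at hlim
  have := ge_of_tendsto' hlim fun n => key n x d hd
  exact sub_eq_zero.1 (abs_eq_zero.1 (le_antisymm this (abs_nonneg _)))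

lemma abs_harm_sub_le {d : ℝ} (n : ℕ) {x : Fin 3 → ℝ} (hx : ∀ b c, |x b - x c| ≤ d) {ω ω' : Addr}
    (h : ∀ j < n, ω j = ω' j) : |harm x ω - harm x ω'| ≤ 2 * d * (3 / 5) ^ n := by
  induction n generalizing x d ω ω' with
  | zero =>
    have h1 := abs_le.1 (harm_sub_mem hx ω 0)
    have h2 := abs_le.1 (harm_sub_mem hx ω' 0)
    rw [abs_le, pow_zero, mul_one]
    constructor <;> linarith
  | succ n ih =>
    rw [← Addr.cons_tail ω, ← Addr.cons_tail ω', ← h 0 (Nat.succ_pos n), harm_cons, harm_cons]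
    refine (ih (abs_harmStep_sub_le hx (ω 0)) fun j hj => h (j + 1) (Nat.succ_lt_succ hj)).trans_eq ?_
    rw [pow_succ']; ring

lemma continuous_harm (x : Fin 3 → ℝ) : Continuous (harm x) := by
  obtain ⟨d, hd⟩ := exists_osc_bound x
  refine continuous_iff_continuousAt.2 fun ω => Metric.tendsto_nhds.2 fun ε hε => ?_
  have hlim : Tendsto (fun n : ℕ => 2 * d * (3 / 5 : ℝ) ^ n) atTop (𝓝 (2 * d * 0)) :=
    (tendsto_pow_atTop_nhds_zero_of_lt_one (by norm_num) (by norm_num)).const_mul _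
  rw [mul_zero] at hlim
  obtain ⟨n, hn⟩ := (hlim.eventually_lt_const hε).exists
  have hnear : ∀ᶠ ω' in 𝓝 ω, ∀ j ∈ Finset.range n, ω' j = ω j := by
    refine (Filter.eventually_all_finset _).2 fun j _ => ?_
    exact ((continuous_apply (A := fun _ => Fin 3) j).tendsto ω).eventually_mem
      ((isOpen_discrete {ω j}).mem_nhds rfl)
  filter_upwards [hnear] with ω' hω'
  rw [Real.dist_eq]
  exact (abs_harm_sub_le n hd fun j hj => hω' j (Finset.mem_range.2 hj)).trans_lt hn

/-- Common initial letters are stripped by induction on a place where the addresses differ. If the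
first letters `a` and `b` differ, the point is shared by two subcells, so the addresses are `a b b
…` and `b a a …`. -/
lemma harm_eq_of_coding_eq (x : Fin 3 → ℝ) {ω ω' : Addr} (h : coding ω = coding ω') :
    harm x ω = harm x ω' := by
  by_cases hne : ω = ω'
  · rw [hne]
  obtain ⟨n, hn⟩ := Function.ne_iff.1 hne
  clear hne
  induction n using Nat.strong_induction_on generalizing x ω ω' with
  | _ n ih =>
  by_cases h0 : ω 0 = ω' 0
  · cases n with
    | zero => exact absurd h0 hn
    | succ n =>
      rw [coding_eq ω, coding_eq ω', h0] at h
      rw [← Addr.cons_tail ω, ← Addr.cons_tail ω', h0, harm_cons, harm_cons]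
      exact ih n (Nat.lt_succ_self n) _ (F_injective _ h) hn
  -- The two subcells are realised as cells of the infinite gasket, so that `cell_inter` applies to
  -- them.
  · have hc : cellPoint 0 (child (rootCell 1) (ω 0)) (Addr.tail ω) =
        cellPoint 0 (child (rootCell 1) (ω' 0)) (Addr.tail ω') := by
      rw [cellPoint_child, cellPoint_child, Addr.cons_tail, Addr.cons_tail]
      exact Subtype.ext (by rw [coe_cellPoint, coe_cellPoint, h])
    have hij : child (rootCell 1) (ω 0) ≠ child (rootCell 1) (ω' 0) := fun h' =>
      h0 (child_injective h').2
    obtain ⟨c, hc1⟩ := cell_inter hij hc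
    obtain ⟨c', hc2⟩ := cell_inter hij.symm hc.symm
    rw [coding_eq ω, coding_eq ω', hc1, hc2, coding_const, coding_const] at h
    have hX := congrArg baryX h
    have hY := congrArg baryY h
    rw [baryX_F, baryX_F, baryX_corner, baryX_corner] at hX
    rw [baryY_F, baryY_F, baryY_corner, baryY_corner] at hY
    rw [← Addr.cons_tail ω, ← Addr.cons_tail ω', harm_cons, harm_cons, hc1, hc2, harm_const,
      harm_const]
    have hcc : c = ω' 0 ∧ c' = ω 0 := by
      generalize ω 0 = a at *
      generalize ω' 0 = b at *
      clear hc hij hc1 hc2 h ih hn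
      fin_cases a <;> fin_cases b <;> fin_cases c <;> fin_cases c' <;> simp at h0 hX hY ⊢
    rw [hcc.1, hcc.2, harmStep_comm]

/-! ### Harmonic splines -/

/-- `g` is harmonic on all cells of side `2 ^ k`. -/
def IsSpline (k : ℤ) (g : infGasket → ℝ) : Prop :=
  ∀ i ω, g (cellPoint k i ω) = harm (fun a => g (vertex k i a)) ω

lemma harm_vertex_eq (k : ℤ) (f : infGasket → ℝ) {i j : CellIndex} {ω ω' : Addr}
    (h : cellPoint k i ω = cellPoint k j ω') :
    harm (fun a => f (vertex k i a)) ω = harm (fun a => f (vertex k j a)) ω' := by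
  by_cases hij : i = j
  · subst hij
    exact harm_eq_of_coding_eq _ (coding_eq_of_cellPoint_eq h)
  · obtain ⟨a, rfl⟩ := cell_inter hij h
    obtain ⟨b, rfl⟩ := cell_inter (Ne.symm hij) h.symm
    rw [harm_const, harm_const]
    exact congrArg f h

/-- The function that is harmonic on the cells of side `2 ^ k` and equals `f` at their corners. -/
noncomputable def spline (k : ℤ) (f : infGasket → ℝ) (z : infGasket) : ℝ :=
  harm (fun a => f (vertex k (exists_cellPoint_eq k z).choose a))
    (exists_cellPoint_eq k z).choose_spec.choose

lemma spline_cellPoint (k : ℤ) (f : infGasket → ℝ) (i : CellIndex) (ω : Addr) :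
    spline k f (cellPoint k i ω) = harm (fun a => f (vertex k i a)) ω :=
  harm_vertex_eq k f (exists_cellPoint_eq k (cellPoint k i ω)).choose_spec.choose_spec

lemma spline_vertex (k : ℤ) (f : infGasket → ℝ) (i : CellIndex) (a : Fin 3) :
    spline k f (vertex k i a) = f (vertex k i a) := by
  rw [vertex, spline_cellPoint, harm_const, vertex]

lemma isSpline_spline (k : ℤ) (f : infGasket → ℝ) : IsSpline k (spline k f) := fun i ω => by
  rw [spline_cellPoint]
  simp only [spline_vertex]

/-- Cells form a locally finite closed cover, and on each cell continuity descends from the compact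
address space, since `cellPoint k i` maps closed sets to closed sets. -/
lemma continuous_of_isSpline {k : ℤ} {g : infGasket → ℝ} (hg : IsSpline k g) : Continuous g := by
  refine (locallyFinite_dyadicTriangle k).continuous ?_ (fun i => isClosed_dyadicTriangle i k) ?_
  · refine Set.eq_univ_of_forall fun z => ?_
    obtain ⟨i, ω, h⟩ := exists_cellPoint_eq k z
    exact Set.mem_iUnion.2 ⟨i, by rw [dyadicTriangle_eq_range]; exact ⟨ω, h⟩⟩
  · intro i
    rw [dyadicTriangle_eq_range, continuousOn_iff_isClosed]
    intro t ht
    have hcont : Continuous fun ω => g (cellPoint k i ω) := by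
      simp only [hg i]; exact continuous_harm _
    refine ⟨cellPoint k i '' ((fun ω => g (cellPoint k i ω)) ⁻¹' t),
      (((ht.preimage hcont).isCompact).image (continuous_cellPoint k i)).isClosed, ?_⟩
    ext z
    constructor
    · rintro ⟨h, ω, rfl⟩
      exact ⟨⟨ω, h, rfl⟩, ω, rfl⟩
    · rintro ⟨⟨ω, h, rfl⟩, h'⟩
      exact ⟨h, h'⟩

lemma IsSpline.vertex_child {k : ℤ} {g : infGasket → ℝ} (hg : IsSpline (k + 1) g) (i : CellIndex)
    (a b : Fin 3) :
    g (vertex k (child i a) b) = harmStep a (fun c => g (vertex (k + 1) i c)) b := by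
  rw [vertex, cellPoint_child, hg, harm_cons, harm_const]

lemma IsSpline.pred {k : ℤ} {g : infGasket → ℝ} (hg : IsSpline (k + 1) g) : IsSpline k g := by
  intro i ω
  obtain ⟨j, a, rfl⟩ := exists_eq_child i
  rw [cellPoint_child, hg, harm_cons]
  congr 1
  funext b
  exact (hg.vertex_child j a b).symm

/-- The equality case of `edgeEnergy_succ_le`: harmonic midpoint values are the minimisers. -/
lemma IsSpline.totalEnergy_pred {k : ℤ} {g : infGasket → ℝ} (hg : IsSpline (k + 1) g) :
    totalEnergy g k = ENNReal.ofReal (3 / 5) * totalEnergy g (k + 1) := by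
  rw [totalEnergy, totalEnergy, ← tsum_child (edgeEnergy g k), ← ENNReal.tsum_mul_left]
  refine tsum_congr fun i => ?_
  simp only [edgeEnergy_eq_ofReal]
  rw [← ENNReal.ofReal_sum_of_nonneg fun c _ => Finset.sum_nonneg fun a _ =>
      Finset.sum_nonneg fun b _ => sq_nonneg _, ← ENNReal.ofReal_mul (by norm_num)]
  congr 1
  simp only [hg.vertex_child, harmStep, Fin.sum_univ_three]
  simp
  ring

lemma IsSpline.totalEnergy_sub {k : ℤ} {g : infGasket → ℝ} (hg : IsSpline k g) (n : ℕ) :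
    IsSpline (k - n) g ∧
      totalEnergy g (k - n) = ENNReal.ofReal ((3 / 5) ^ n) * totalEnergy g k := by
  induction n with
  | zero => simpa using hg
  | succ n ih =>
    have hk : k - (n : ℤ) = (k - ((n + 1 : ℕ) : ℤ)) + 1 := by push_cast; ring
    rw [hk] at ih
    refine ⟨ih.1.pred, ?_⟩
    rw [ih.1.totalEnergy_pred, ih.2, ← mul_assoc, ← ENNReal.ofReal_mul (by norm_num), pow_succ']

/-- Renormalised energies are constant at scales finer than `k` by harmonicity and cannot exceed
that constant at coarser ones, so one scale controls the supremum. -/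
lemma IsSpline.energy_le {k : ℤ} {g : infGasket → ℝ} (hg : IsSpline k g) :
    energy g ≤ ENNReal.ofReal ((5 / 3) ^ (-k)) * totalEnergy g k := by
  refine iSup_le fun m => (levelEnergy_le m g).trans ?_
  obtain ⟨n, hn | hn⟩ := (k + m).eq_nat_or_neg
  · have hm : (-(m : ℤ)) = k - n := by linarith
    rw [hm, (hg.totalEnergy_sub n).2, ← mul_assoc, ← ENNReal.ofReal_mul (by positivity)]
    refine mul_le_mul_left (ENNReal.ofReal_le_ofReal ?_) _
    rw [show -k = (m : ℤ) - n by linarith, zpow_sub₀ (by norm_num), zpow_natCast, zpow_natCast,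
      show (3 / 5 : ℝ) = (5 / 3)⁻¹ by norm_num, inv_pow,
      div_eq_mul_inv ((5 / 3 : ℝ) ^ m)]
    have : (0 : ℝ) < (5 / 3) ^ m * ((5 / 3) ^ n)⁻¹ := by positivity
    linarith
  · have hm : (-(m : ℤ)) = k + n := by linarith
    rw [hm]
    refine (mul_le_mul_right (totalEnergy_add_le g k n) _).trans ?_
    rw [← mul_assoc, ← ENNReal.ofReal_mul (by positivity)]
    refine mul_le_mul_left (ENNReal.ofReal_le_ofReal ?_) _
    rw [show -k = (m : ℤ) + n by linarith, zpow_add₀ (by norm_num), zpow_natCast, zpow_natCast]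
    have : (0 : ℝ) < (5 / 3) ^ m * (5 / 3) ^ n := by positivity
    linarith

/-! ### The test functions -/

/-- The midpoint of one side of a cell. -/
noncomputable def midpoint (k : ℤ) (i : CellIndex) : infGasket := vertex (k - 1) (child i 0) 1

/-- The harmonic spline on the cells of side `2 ^ (k - 1)` that equals one at one midpoint of the
cell of side `2 ^ k` with label `i` and zero at all other vertices. -/
noncomputable def bump (k : ℤ) (i : CellIndex) : infGasket → ℝ :=
  spline (k - 1) (Set.indicator {midpoint k i} fun _ => 1)

lemma isSpline_bump (k : ℤ) (i : CellIndex) : IsSpline (k - 1) (bump k i) := isSpline_spline _ _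

lemma bump_mem_Icc (k : ℤ) (i : CellIndex) (z : infGasket) : bump k i z ∈ Set.Icc (0 : ℝ) 1 := by
  obtain ⟨j, ω, rfl⟩ := exists_cellPoint_eq (k - 1) z
  rw [bump, spline_cellPoint]
  refine harm_mem_Icc (fun b => ?_) ω
  by_cases h : vertex (k - 1) j b ∈ ({midpoint k i} : Set infGasket) <;> simp [h]

/-- The peak is a midpoint rather than a corner because a midpoint belongs to no other cell of side
`2 ^ k`: its address `0 1 1 …` is not constant. Hence only `σ` of the cell itself enters the norm of
the bump. -/
lemma bump_eq_zero {k : ℤ} {i : CellIndex} {z : infGasket} (hz : z ∉ dyadicTriangle i k) :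
    bump k i z = 0 := by
  obtain ⟨l, rfl⟩ : ∃ l, k = l + 1 := ⟨k - 1, by ring⟩
  obtain ⟨j, ω, rfl⟩ := exists_cellPoint_eq l z
  obtain ⟨i', a, rfl⟩ := exists_eq_child j
  have hne : i' ≠ i := by
    rintro rfl
    refine hz ?_
    rw [dyadicTriangle_eq_range, cellPoint_child]
    exact ⟨_, rfl⟩
  have hb : ∀ b, vertex l (child i' a) b ≠ midpoint (l + 1) i := by
    intro b h
    rw [midpoint, add_sub_cancel_right, vertex, vertex, cellPoint_child, cellPoint_child] at h
    obtain ⟨c, hc⟩ := cell_inter hne.symm h.symm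
    have h0 := congrFun hc 0
    have h1 := congrFun hc 1
    exact absurd (h0.trans h1.symm) (by simp [Addr.cons, Addr.const])
  have hzero : ∀ b, Set.indicator {midpoint (l + 1) i} (fun _ => (1 : ℝ))
      (vertex l (child i' a) b) = 0 := fun b =>
    Set.indicator_of_notMem (fun h => hb b (Set.mem_singleton_iff.1 h)) _
  rw [bump, add_sub_cancel_right, spline_cellPoint]
  simp only [hzero]
  have := harm_mem_Icc (l := 0) (r := 0) (x := fun _ => 0) (fun _ => by simp) ω
  simpa using this

/-- The small cell has the peak as a corner. One harmonic step from the corner values `0, 1, 0`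
gives `2/5, 1, 2/5`, and the maximum principle does the rest. -/
lemma le_bump {k : ℤ} {i : CellIndex} {z : infGasket}
    (hz : z ∈ dyadicTriangle (child (child i 0) 1) (k - 2)) : 2 / 5 ≤ bump k i z := by
  obtain ⟨l, rfl⟩ : ∃ l, k = l + 1 + 1 := ⟨k - 2, by ring⟩
  rw [show l + 1 + 1 - 2 = l by ring, dyadicTriangle_eq_range] at hz
  obtain ⟨ω, rfl⟩ := hz
  have hp : ∀ b, Set.indicator {midpoint (l + 1 + 1) i} (fun _ => (1 : ℝ))
      (vertex (l + 1) (child i 0) b) = if b = 1 then 1 else 0 := by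
    intro b
    rw [midpoint, add_sub_cancel_right, Set.indicator_apply]
    congr 1
    rw [Set.mem_singleton_iff, (vertex_injective _ _).eq_iff]
  rw [bump, add_sub_cancel_right, cellPoint_child, spline_cellPoint]
  simp only [hp]
  rw [harm_cons]
  refine (harm_mem_Icc (l := 2 / 5) (r := 1) (fun b => ?_) ω).1
  fin_cases b <;> norm_num [harmStep, Fin.sum_univ_three]

/-- At most six cells contain the peak, and each has nine ordered pairs of corners with squared
difference at most one. -/
lemma totalEnergy_bump_le (k : ℤ) (i : CellIndex) : totalEnergy (bump k i) (k - 1) ≤ 54 := by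
  have hcell : ∀ j, edgeEnergy (bump k i) (k - 1) j ≤
      9 * (dyadicTriangle j (k - 1)).indicator (fun _ => (1 : ENNReal)) (midpoint k i) := by
    intro j
    by_cases hj : midpoint k i ∈ dyadicTriangle j (k - 1)
    · rw [Set.indicator_of_mem hj, mul_one, edgeEnergy]
      have h1 : ∀ a b, ENNReal.ofReal ((bump k i (vertex (k - 1) j a) -
          bump k i (vertex (k - 1) j b)) ^ 2) ≤ 1 := by
        intro a b
        have ha := bump_mem_Icc k i (vertex (k - 1) j a)
        have hb := bump_mem_Icc k i (vertex (k - 1) j b)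
        rw [ENNReal.ofReal_le_one, sq_le_one_iff_abs_le_one, abs_le]
        constructor <;> linarith [ha.1, ha.2, hb.1, hb.2]
      refine (Finset.sum_le_sum fun a _ => Finset.sum_le_sum fun b _ => h1 a b).trans_eq ?_
      simp
      norm_num
    · have h0 : ∀ a, bump k i (vertex (k - 1) j a) = 0 := by
        intro a
        rw [bump, spline_vertex]
        refine Set.indicator_of_notMem (fun h => hj ?_) _
        rw [← Set.mem_singleton_iff.1 h, dyadicTriangle_eq_range]
        exact ⟨_, rfl⟩
      simp [edgeEnergy, h0]
  refine (ENNReal.tsum_le_tsum hcell).trans ?_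
  rw [ENNReal.tsum_mul_left]
  refine (mul_le_mul_right (tsum_indicator_dyadicTriangle_le _ _) _).trans_eq ?_
  norm_num

lemma energy_bump_le (k : ℤ) (i : CellIndex) :
    energy (bump k i) ≤ ENNReal.ofReal (90 * (5 / 3) ^ (-k)) := by
  refine (isSpline_bump k i).energy_le.trans
    ((mul_le_mul_right (totalEnergy_bump_le k i) _).trans_eq ?_)
  rw [show (54 : ENNReal) = ENNReal.ofReal 54 by simp, ← ENNReal.ofReal_mul (by positivity)]
  congr 1
  rw [neg_sub, sub_eq_add_neg, zpow_add₀ (by norm_num), zpow_one]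
  ring

lemma eLpNorm_bump_le (k : ℤ) (i : CellIndex) (p : ENNReal) (σ : Measure infGasket) :
    eLpNorm (bump k i) p σ ≤ σ (dyadicTriangle i k) ^ p⁻¹.toReal := by
  have h : ∀ z, ‖bump k i z‖ ≤ (dyadicTriangle i k).indicator (fun _ => (1 : ℝ)) z := by
    intro z
    by_cases hz : z ∈ dyadicTriangle i k
    · rw [Set.indicator_of_mem hz, Real.norm_of_nonneg (bump_mem_Icc k i z).1]
      exact (bump_mem_Icc k i z).2
    · rw [bump_eq_zero hz, Set.indicator_of_notMem hz, norm_zero]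
  refine (eLpNorm_mono_real h).trans ((eLpNorm_indicator_const_le _ _).trans_eq ?_)
  rw [enorm_one, one_mul, ENNReal.toReal_inv, one_div]

lemma le_eLpNorm_bump (k : ℤ) (i : CellIndex) {q : ENNReal} (hq : q ≠ 0) :
    ENNReal.ofReal (2 / 5 * 3 ^ (((k : ℝ) - 2) * q⁻¹.toReal)) ≤
      eLpNorm (bump k i) q infMeasure := by
  set S := dyadicTriangle (child (child i 0) 1) (k - 2) with hS
  have hν : infMeasure S = ENNReal.ofReal (3 ^ ((k : ℝ) - 2)) := by
    rw [hS, infMeasure_dyadicTriangle, ← ENNReal.ofReal_rpow_of_pos (by norm_num)]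
    simp
  have hν0 : infMeasure S ≠ 0 := by
    rw [hν, Ne, ENNReal.ofReal_eq_zero, not_le]; positivity
  have h : ∀ z, ‖S.indicator (fun _ => (2 / 5 : ℝ)) z‖ ≤ ‖bump k i z‖ := by
    intro z
    by_cases hz : z ∈ S
    · rw [Set.indicator_of_mem hz, Real.norm_of_nonneg (by norm_num),
        Real.norm_of_nonneg (bump_mem_Icc k i z).1]
      exact le_bump hz
    · rw [Set.indicator_of_notMem hz, norm_zero]; exact norm_nonneg _
  refine le_trans (le_of_eq ?_) (eLpNorm_mono h)
  rw [eLpNorm_indicator_const' (isClosed_dyadicTriangle _ _).measurableSet hν0 hq, hν,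
    ENNReal.ofReal_rpow_of_pos (by positivity), Real.enorm_of_nonneg (by norm_num),
    ← ENNReal.ofReal_mul (by norm_num), ← Real.rpow_mul (by norm_num), ENNReal.toReal_inv, one_div]

lemma bump_mem_formDomain (k : ℤ) (i : CellIndex) : bump k i ∈ formDomain := by
  have hc := continuous_of_isSpline (isSpline_bump k i)
  refine ⟨hc, (energy_bump_le k i).trans_lt ENNReal.ofReal_lt_top,
    hc.measurable.aestronglyMeasurable, (eLpNorm_bump_le k i 2 infMeasure).trans_lt ?_⟩
  have h3 : (3 : ENNReal) ^ (k : ℝ) = ENNReal.ofReal (3 ^ (k : ℝ)) := by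
    rw [← ENNReal.ofReal_rpow_of_pos (by norm_num)]; simp
  rw [infMeasure_dyadicTriangle, h3]
  exact ENNReal.rpow_lt_top_of_nonneg ENNReal.toReal_nonneg ENNReal.ofReal_ne_top

/-! ### Optimality of the exponents -/

/-- The assumed inequality is applied to the bump. The constant is `2025 = (5/2) * 9 * 90`: the
height `2/5`, the loss `3 ^ (-2/q) ≥ 1/9` from the smaller cell, and the energy constant `90`. -/
lemma one_le_sum_of_inequality {p q : ENNReal} (h2q : 2 ≤ q) {σ : Measure infGasket} {N : ℕ}
    {b : Fin N → ℝ} {C : ℝ} (hb : ∀ j, b j ∈ Set.Icc (0 : ℝ) 1) (hC : 0 < C)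
    (hineq : ∀ u ∈ formDomain, eLpNorm u p σ < ⊤ → eLpNorm u q infMeasure ≤
      ENNReal.ofReal C * ∑ j, energy u ^ (b j / 2) * eLpNorm u p σ ^ (1 - b j))
    (k : ℤ) (i : CellIndex) {s : ℝ} (hs : 0 < s)
    (hσ : σ (dyadicTriangle i k) = ENNReal.ofReal s) :
    1 ≤ 2025 * C * ∑ j, (3 ^ ((k : ℝ) * (-(b j * (1 / (2 * deltaS))) - q⁻¹.toReal)) *
      s ^ (p⁻¹.toReal * (1 - b j))) := by
  set Q := q⁻¹.toReal with hQ
  set P := p⁻¹.toReal with hP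
  set D := 1 / (2 * deltaS) with hD
  have hQ0 : 0 ≤ Q := ENNReal.toReal_nonneg
  have hQ1 : Q ≤ 1 := by
    have h1 := ENNReal.toReal_mono (by norm_num) (ENNReal.inv_le_inv.2 h2q)
    rw [← hQ, ENNReal.toReal_inv, ENNReal.toReal_ofNat] at h1
    linarith
  have hnorm : eLpNorm (bump k i) p σ ≤ ENNReal.ofReal (s ^ P) := by
    refine (eLpNorm_bump_le k i p σ).trans_eq ?_
    rw [hσ, ENNReal.ofReal_rpow_of_pos hs]
  have hq0 : q ≠ 0 := (lt_of_lt_of_le (by norm_num) h2q).ne'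
  have hmain := (le_eLpNorm_bump k i hq0).trans
    (hineq _ (bump_mem_formDomain k i) (hnorm.trans_lt ENNReal.ofReal_lt_top))
  have hterm : ∀ j, energy (bump k i) ^ (b j / 2) * eLpNorm (bump k i) p σ ^ (1 - b j) ≤
      ENNReal.ofReal (90 * (3 ^ ((k : ℝ) * -(b j * D)) * s ^ (P * (1 - b j)))) := by
    intro j
    have hb2 : 0 ≤ b j / 2 := by linarith [(hb j).1]
    have h1 := ENNReal.rpow_le_rpow (energy_bump_le k i) hb2
    have h2 := ENNReal.rpow_le_rpow hnorm (sub_nonneg.2 (hb j).2)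
    rw [ENNReal.ofReal_rpow_of_pos (by positivity)] at h1 h2
    refine (mul_le_mul' h1 h2).trans ?_
    rw [← ENNReal.ofReal_mul (by positivity), ← Real.rpow_mul hs.le, ← mul_assoc]
    refine ENNReal.ofReal_le_ofReal (mul_le_mul_of_nonneg_right ?_ (by positivity))
    rw [Real.mul_rpow (by norm_num) (by positivity)]
    have h4 : ((5 / 3 : ℝ) ^ (-k)) ^ (b j / 2) = 3 ^ ((k : ℝ) * -(b j * D)) := by
      rw [← three_rpow_deltaS, ← Real.rpow_mul_intCast (by norm_num), ← Real.rpow_mul (by norm_num)]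
      congr 1
      rw [hD, mul_comm (2 : ℝ) deltaS, ← div_div]; push_cast; ring
    have h5 : (90 : ℝ) ^ (b j / 2) ≤ 90 := by
      conv_rhs => rw [← Real.rpow_one 90]
      exact Real.rpow_le_rpow_of_exponent_le (by norm_num) (by linarith [(hb j).2])
    rw [h4]
    exact mul_le_mul_of_nonneg_right h5 (by positivity)
  have hsum := hmain.trans (mul_le_mul_right (Finset.sum_le_sum fun j _ => hterm j) _)
  rw [← ENNReal.ofReal_sum_of_nonneg fun j _ => by positivity, ← ENNReal.ofReal_mul hC.le,
    ENNReal.ofReal_le_ofReal_iff (mul_nonneg hC.le (Finset.sum_nonneg fun j _ => by positivity)),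
    ← Finset.mul_sum] at hsum
  have hlow : (3 : ℝ) ^ ((k : ℝ) * Q) / 9 ≤ 3 ^ (((k : ℝ) - 2) * Q) := by
    have h1 : ((k : ℝ) - 2) * Q ≥ (k : ℝ) * Q - (2 : ℕ) := by push_cast; nlinarith
    refine le_trans (le_of_eq ?_) (Real.rpow_le_rpow_of_exponent_le (by norm_num) h1)
    rw [Real.rpow_sub (by norm_num), Real.rpow_natCast]
    norm_num
  have hfac : ∑ j, ((3 : ℝ) ^ ((k : ℝ) * (-(b j * D) - Q)) * s ^ (P * (1 - b j))) =
      3 ^ (-((k : ℝ) * Q)) * ∑ j, (3 ^ ((k : ℝ) * -(b j * D)) * s ^ (P * (1 - b j))) := by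
    rw [Finset.mul_sum]
    refine Finset.sum_congr rfl fun j _ => ?_
    rw [← mul_assoc, ← Real.rpow_add (by norm_num)]
    congr 2; ring
  rw [hfac, Real.rpow_neg (by norm_num), mul_left_comm, inv_mul_eq_div,
    le_div_iff₀ (by positivity), one_mul]
  linarith

/-- A finite sum bounded away from zero cannot have all its terms tend to zero, so one index `j`
survives along the whole filter. -/
lemma not_tendsto_atBot_of_one_le {ι : Type*} {L : Filter ι} [L.NeBot] {N : ℕ} {c : ℝ}
    {g : Fin N → ι → ℝ} (h : ∀ᶠ m in L, 1 ≤ c * ∑ j, (3 : ℝ) ^ g j m) :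
    ∃ j, ¬ Tendsto (g j) L atBot := by
  by_contra! hcon
  have hlim : Tendsto (fun m => c * ∑ j, (3 : ℝ) ^ g j m) L (𝓝 (c * ∑ _j : Fin N, 0)) :=
    (tendsto_finsetSum _ fun j _ =>
      (tendsto_rpow_atBot_of_base_gt_one 3 (by norm_num)).comp (hcon j)).const_mul c
  have := ge_of_tendsto hlim h
  simp at this
  linarith

/-- Along cells with local dimension `y m`, the inequality forces a comparison of exponents. -/
lemma exists_not_tendsto_of_inequality {p q : ENNReal} (h2q : 2 ≤ q) {σ : Measure infGasket}
    {N : ℕ} {b : Fin N → ℝ} {C : ℝ} (hb : ∀ j, b j ∈ Set.Icc (0 : ℝ) 1) (hC : 0 < C)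
    (hineq : ∀ u ∈ formDomain, eLpNorm u p σ < ⊤ → eLpNorm u q infMeasure ≤
      ENNReal.ofReal C * ∑ j, energy u ^ (b j / 2) * eLpNorm u p σ ^ (1 - b j))
    {ι : Type*} {L : Filter ι} [L.NeBot] {i : ι → CellIndex} {k : ι → ℤ} {Y : ℝ} (hY : 0 < Y)
    (hlim : Tendsto (fun m => Real.log (σ (dyadicTriangle (i m) (k m))).toReal /
      Real.log (infMeasure (dyadicTriangle (i m) (k m))).toReal) L (𝓝 Y)) :
    ∃ j, ∃ y : ι → ℝ, Tendsto y L (𝓝 Y) ∧ ¬ Tendsto (fun m => (k m : ℝ) *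
      (-(b j * (1 / (2 * deltaS))) - q⁻¹.toReal + y m * (p⁻¹.toReal * (1 - b j)))) L atBot := by
  set y : ι → ℝ := fun m => Real.log (σ (dyadicTriangle (i m) (k m))).toReal /
      Real.log (infMeasure (dyadicTriangle (i m) (k m))).toReal with hy
  obtain ⟨j, hj⟩ := not_tendsto_atBot_of_one_le (L := L) (c := 2025 * C)
    (g := fun j m => (k m : ℝ) *
      (-(b j * (1 / (2 * deltaS))) - q⁻¹.toReal + y m * (p⁻¹.toReal * (1 - b j)))) (by
    filter_upwards [hlim.eventually_const_lt hY] with m hm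
    set s := (σ (dyadicTriangle (i m) (k m))).toReal with hs
    have hνlog : Real.log (infMeasure (dyadicTriangle (i m) (k m))).toReal =
        (k m : ℝ) * Real.log 3 := by
      rw [infMeasure_dyadicTriangle, ← ENNReal.toReal_rpow, ENNReal.toReal_ofNat,
        Real.log_rpow (by norm_num)]
    -- The quotient of logarithms is positive here, which excludes the junk values: `log 0 = 0`
    -- rules out mass zero and, through `toReal`, mass infinity, and division by zero rules out `k m
    -- = 0`.
    have hs0 : s ≠ 0 := by
      intro h0
      simp only [hy, h0, ← hs, Real.log_zero, zero_div] at hm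
      exact lt_irrefl _ hm
    have hspos : 0 < s := lt_of_le_of_ne ENNReal.toReal_nonneg hs0.symm
    have hkne : (k m : ℝ) * Real.log 3 ≠ 0 := by
      intro h0
      simp only [hy, hνlog, h0, div_zero] at hm
      exact lt_irrefl _ hm
    have hslog : Real.log s = Real.log 3 * ((k m : ℝ) * y m) := by
      have : y m = Real.log s / ((k m : ℝ) * Real.log 3) := by simp only [hy, hνlog, hs]
      rw [this, ← mul_assoc, mul_comm (Real.log 3), mul_div_cancel₀ _ hkne]
    have hσs : σ (dyadicTriangle (i m) (k m)) = ENNReal.ofReal s :=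
      (ENNReal.ofReal_toReal fun h => hs0 (by rw [hs, h, ENNReal.toReal_top])).symm
    refine (one_le_sum_of_inequality h2q hb hC hineq (k m) (i m) hspos hσs).trans_eq ?_
    congr 1
    refine Finset.sum_congr rfl fun j _ => ?_
    have hs3 : s = 3 ^ ((k m : ℝ) * y m) := by
      rw [Real.rpow_def_of_pos (by norm_num), ← hslog, Real.exp_log hspos]
    rw [hs3, ← Real.rpow_mul (by norm_num), ← Real.rpow_add (by norm_num)]
    congr 1; ring_nf)
  exact ⟨j, y, hlim, hj⟩

lemma tendsto_growth {ι : Type*} {L : Filter ι} {y : ι → ℝ} {Y : ℝ} (hy : Tendsto y L (𝓝 Y))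
    (c d : ℝ) : Tendsto (fun m => c + y m * d) L (𝓝 (c + Y * d)) :=
  (hy.mul_const d).const_add c

lemma optimal_exponents {p q : ENNReal} (h2q : 2 ≤ q) {δl δu : ℝ} (hδl : 0 < δl) (hle : δl ≤ δu)
    {σ : Measure infGasket} (hsharp : SharpDyadic σ δl δu) {N : ℕ} {b : Fin N → ℝ} {C : ℝ}
    (hb : ∀ j, b j ∈ Set.Icc (0 : ℝ) 1) (hC : 0 < C)
    (hineq : ∀ u ∈ formDomain, eLpNorm u p σ < ⊤ → eLpNorm u q infMeasure ≤
      ENNReal.ofReal C * ∑ j, energy u ^ (b j / 2) * eLpNorm u p σ ^ (1 - b j)) :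
    (⨅ j, b j) ≤ exponent p q δu ∧ exponent p q δu ≤ exponent p q δl ∧
      exponent p q δl ≤ ⨆ j, b j := by
  have hδu : 0 < δu := hδl.trans_le hle
  obtain ⟨T, hT, hdiam0, hdiamtop, hlim0, hlimtop⟩ := hsharp
  choose i k hik using hT
  obtain rfl : T = fun m => dyadicTriangle (i m) (k m) := funext hik
  have hlog2 : 0 < Real.log 2 := Real.log_pos (by norm_num)
  simp only [diam_dyadicTriangle] at hdiam0 hdiamtop
  have hkbot : Tendsto (fun m => (k m : ℝ)) atBot atBot := by
    have h1 : Tendsto (fun m => (2 : ℝ) ^ k m) atBot (𝓝[>] 0) :=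
      tendsto_nhdsWithin_of_tendsto_nhds_of_eventually_within _ hdiam0
        (Eventually.of_forall fun m => Set.mem_Ioi.2 (by positivity))
    have h2 := Real.tendsto_log_nhdsGT_zero.comp h1
    simp only [Function.comp_def, Real.log_zpow] at h2
    exact (tendsto_mul_const_atBot_of_pos hlog2).1 h2
  have hktop : Tendsto (fun m => (k m : ℝ)) atTop atTop := by
    have h2 := Real.tendsto_log_atTop.comp hdiamtop
    simp only [Function.comp_def, Real.log_zpow] at h2
    exact (tendsto_mul_const_atTop_of_pos hlog2).1 h2
  have hP0 : 0 ≤ p⁻¹.toReal := ENNReal.toReal_nonneg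
  have hQ0 : 0 ≤ q⁻¹.toReal := ENNReal.toReal_nonneg
  have hD := one_div_two_deltaS.1
  have hpos : ∀ δ, 0 < δ → 0 < p⁻¹.toReal / δ + 1 / (2 * deltaS) := fun δ hδ => by positivity
  refine ⟨?_, ?_, ?_⟩
  · obtain ⟨j, y, hy, hj⟩ := exists_not_tendsto_of_inequality h2q hb hC hineq
      (one_div_pos.2 hδu) hlimtop
    refine (ciInf_le (Set.finite_range b).bddBelow j).trans (le_max_of_le_left ?_)
    rw [le_div_iff₀ (hpos δu hδu)]
    -- Otherwise the limiting growth rate is negative, and multiplied by `k m → ∞` it sends the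
    -- surviving term to zero.
    by_contra! hlt
    refine hj (hktop.atTop_mul_neg ?_ (tendsto_growth hy _ _))
    have : 1 / δu * (p⁻¹.toReal * (1 - b j)) = p⁻¹.toReal / δu * (1 - b j) := by ring
    rw [this]
    linarith
  -- The quotient `(x - 1/q) / (x + 1/(2δₛ))` increases with `x = 1/(pδ)`.
  · refine max_le_max ?_ le_rfl
    have hx : p⁻¹.toReal / δu ≤ p⁻¹.toReal / δl := div_le_div_of_nonneg_left hP0 hδl hle
    rw [div_le_div_iff₀ (hpos δu hδu) (hpos δl hδl)]
    nlinarith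
  · obtain ⟨j, y, hy, hj⟩ := exists_not_tendsto_of_inequality h2q hb hC hineq
      (one_div_pos.2 hδl) hlim0
    refine le_trans ?_ (le_ciSup (Set.finite_range b).bddAbove j)
    refine max_le ?_ (hb j).1
    rw [div_le_iff₀ (hpos δl hδl)]
    -- Otherwise the limiting growth rate is positive while `k m → -∞`, and again the surviving term
    -- tends to zero.
    by_contra! hlt
    refine hj (hkbot.atBot_mul_pos ?_ (tendsto_growth hy _ _))
    have : 1 / δl * (p⁻¹.toReal * (1 - b j)) = p⁻¹.toReal / δl * (1 - b j) := by ring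
    rw [this]
    linarith

end SierpinskiGasket

theorem mainTheorem8 :
    -- the inequality, with a constant that depends on `Cσ` only
    (∀ Cσ : ℝ, 1 ≤ Cσ → ∃ C : ℝ, 0 < C ∧
      ∀ (p q : ENNReal) (δl δu : ℝ) (σ : Measure infGasket),
        1 ≤ p → p ≤ q → 2 ≤ q → 0 < δl → δl ≤ δu → LowerDyadic σ Cσ δl δu →
        ∀ u ∈ formDomain,
          eLpNorm u q infMeasure ≤ ENNReal.ofReal C *
            (energy u ^ (exponent p q δl / 2) * eLpNorm u p σ ^ (1 - exponent p q δl) +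
             energy u ^ (exponent p q δu / 2) * eLpNorm u p σ ^ (1 - exponent p q δu))) ∧
    -- optimality of the exponents
    (∀ (p q : ENNReal) (Cσ δl δu : ℝ) (σ : Measure infGasket),
        1 ≤ p → p ≤ q → 2 ≤ q → 1 ≤ Cσ → 0 < δl → δl ≤ δu → LowerDyadic σ Cσ δl δu →
        SharpDyadic σ δl δu →
        ∀ (N : ℕ) (b : Fin N → ℝ) (C : ℝ), 0 < N → (∀ i, b i ∈ Set.Icc (0 : ℝ) 1) → 0 < C →
          (∀ u ∈ formDomain, eLpNorm u p σ < ⊤ →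
            eLpNorm u q infMeasure ≤ ENNReal.ofReal C *
              ∑ i, energy u ^ (b i / 2) * eLpNorm u p σ ^ (1 - b i)) →
          (⨅ i, b i) ≤ exponent p q δu ∧ exponent p q δu ≤ exponent p q δl ∧
            exponent p q δl ≤ ⨆ i, b i) := by
  refine ⟨fun Cσ hC => ⟨864 * Cσ, by positivity, ?_⟩, ?_⟩
  · intro p q δl δu σ hp hpq h2q hδl hle hσ u hu
    exact eLpNorm_le_energy_mul_eLpNorm hp hpq h2q hC hδl (hδl.trans_le hle) hσ hu
  · intro p q _ δl δu σ _ _ h2q _ hδl hle _ hsharp N b C _ hb hC hineq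
    exact optimal_exponents h2q hδl hle hsharp hb hC hineq
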